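/- Let $k\ge 2$ be an integer, let $f:\mathbb{R}^{k-1}\to\mathbb{R}$ be smooth and compactly supported, and let $\rho:\mathbb{R}\to\mathbb{R}$ be smooth, compactly supported and non-negative. Let $(a_n)_{n\ge1}$ be a lacunary sequence of positive real numbers, i.e. $a_1>0$ and there is a constant $c>1$ such that $a_{n+1}\ge c\,a_n$ for all integers $n\ge1$. For a real sequence $(b_n)_{n\ge1}$ and an integer $N\ge1$ put $$R_k(f,(b_n),N)=\frac1N\sum_{m\in\mathbb{Z}^{k-1}}\ \sum_{\substack{x=(x_1,\dots,x_k)\in\mathbb{Z}^k\\ 1\le x_1,\dots,x_k\le N\\ x_1,\dots,x_k\ \text{distinct}}} f\bigl(N(\Delta_{(b_n)}(x)-m)\bigr),\qquad \Delta_{(b_n)}(x)=(b_{x_1}-b_{x_2},\,b_{x_2}-b_{x_3},\dots,b_{x_{k-1}}-b_{x_k}),$$ and for $\alpha\in\mathbb{R}$ let $R_k(f,N)(\alpha)=R_k(f,(\alpha a_n),N)$. Let $C_k(N)=\prod_{j=1}^{k-1}\left(1-\frac jN\right)$. Then for every $\eta>0$ there is a constant $C$, depending only on $k,f,\rho,\eta,a_1$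 and $c$, such that for all integers $N\ge1$ the following integral converges and satisfies $$\int_{\mathbb{R}}\Bigl|R_k(f,N)(\alpha)-C_k(N)\int_{\mathbb{R}^{k-1}}f(x)\,dx\Bigr|^2\rho(\alpha)\,d\alpha\ \le\ C\,N^{-1+\eta}.$$ -/

import Mathlib

open MeasureTheory
open scoped ContDiff

noncomputable section

/-- The tuples `x = (x₁, …, x_k)` of pairwise distinct integers with `1 ≤ x_i ≤ N`. -/
def distinctTuples (k N : ℕ) : Finset (Fin k → ℕ) :=
  open Classical in
  (Fintype.piFinset fun _ : Fin k => Finset.Icc 1 N).filter fun x => Function.Injective x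

/-- The vector of consecutive differences
`Δ_a(x) = (a_{x₁} - a_{x₂}, …, a_{x_{k-1}} - a_{x_k})`. -/
def consecutiveDiff {k : ℕ} (a : ℕ → ℝ) (x : Fin k → ℕ) (i : Fin (k - 1)) : ℝ :=
  a (x ⟨i.1, by omega⟩) - a (x ⟨i.1 + 1, by omega⟩)

/-- The `k`-level correlation sum `R_k(f, (a_n), N)`. For compactly supported `f` and `N ≥ 1` only
finitely many terms of the sum over `m ∈ ℤ^{k-1}` are nonzero. -/
def correlationSum (k : ℕ) (f : (Fin (k - 1) → ℝ) → ℝ) (a : ℕ → ℝ) (N : ℕ) : ℝ :=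
  1 / (N : ℝ) * ∑' m : Fin (k - 1) → ℤ, ∑ x ∈ distinctTuples k N,
    f (fun i => (N : ℝ) * (consecutiveDiff a x i - (m i : ℝ)))

/-- `C_k(N) = (1 - 1/N) ⋯ (1 - (k-1)/N)`. -/
def diagFactor (k N : ℕ) : ℝ :=
  ∏ j ∈ Finset.Ico 1 k, (1 - (j : ℝ) / (N : ℝ))

/-- The integrand `|R_k(f,N)(α) - C_k(N) ∫ f|² ρ(α)` of the weighted variance, where
`R_k(f,N)(α) = R_k(f, (α a_n), N)`. -/
def varianceIntegrand (k : ℕ) (f : (Fin (k - 1) → ℝ) → ℝ) (ρ : ℝ → ℝ) (a : ℕ → ℝ) (N : ℕ)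
    (α : ℝ) : ℝ :=
  |correlationSum k f (fun n => α * a n) N - diagFactor k N * ∫ t, f t| ^ 2 * ρ α

/-- The weighted variance `V(R_k(f,N), ρ)`. -/
def correlationVariance (k : ℕ) (f : (Fin (k - 1) → ℝ) → ℝ) (ρ : ℝ → ℝ) (a : ℕ → ℝ)
    (N : ℕ) : ℝ :=
  ∫ α : ℝ, varianceIntegrand k f ρ a N α

end

/-! Poisson summation turns the correlation sum at `α` into `N^{-k} ∑_n f̂(n/N) ∑_x e(α n·Δ_a(x))`,
and the term `n = 0` is exactly `C_k(N) ∫ f`. Decay of `f̂` allows truncation to `0 < max |n_i| ≤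
N^{1+ε}` (`exists_norm_sub_sum_le`). After squaring and integrating against `ρ`, decay of `ρ̂`
leaves only pairs of frequencies at distance at most `N^ε`, each of weight `O(N^{-2k})`
(`integral_norm_sq_sum_le`). It remains to show that there are at most `N^{2k-1+η}` such pairs, up
to a constant (`CountingData.card_pairs_le`).

Summation by parts writes a frequency as `∑ u_i a_{x_i}` with `u ≠ 0` and `∑ u_i = 0`. List its
nonzero terms by decreasing index. Polynomial windows contain only `W = O(N^ε)` indices because the
sequence is lacunary, so powers of `W` are harmless. Cut the list wherever `a` drops by a factor
above `2kM`. Inside a block the top index fixes the other indices up to `W` choices each, and at a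
cut the rest of the list is too small to affect the preceding coefficient much. The level `p` counts
the cuts after which the remaining sum is non-null, that is, comparable with its leading `a_x`.

For lists of `r` terms and level `p`, up to powers of `W`, two counts hold. Near a fixed target
there are at most `N^{r-p}` lists (`CountingData.card_near_target_le`): reading from the top, each
block has its last coefficient determined, and its top index as well if the sum from there on is
non-null. With zero coefficient sum there are at most `N^{r+p-1}` lists
(`CountingData.card_sum_zero_le`): reading from the bottom, each block has a free top index, a null
sum costs one coefficient, and the zero sum costs one more. For two frequencies of levels `p ≤ q`,
counting the first by the second bound and the other by the first bound gives `N^{k+p-1} N^{k-q} ≤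
N^{2k-1}`. -/

/-! ### Linear forms as sorted lists: isolation, nullity and level. -/

/-- The linear form `∑ u a_x` attached to a list of pairs `(x, u)`. -/
def weightedSum (a : ℕ → ℝ) (L : List (ℕ × ℤ)) : ℝ := (L.map fun z => (z.2 : ℝ) * a z.1).sum

@[simp] lemma weightedSum_nil (a : ℕ → ℝ) : weightedSum a [] = 0 := rfl

@[simp] lemma weightedSum_cons (a : ℕ → ℝ) (z : ℕ × ℤ) (L : List (ℕ × ℤ)) :
    weightedSum a (z :: L) = z.2 * a z.1 + weightedSum a L := by simp [weightedSum]

/-- The sum of the coefficients of a list of pairs. -/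
def coeffSum (L : List (ℕ × ℤ)) : ℤ := (L.map Prod.snd).sum

@[simp] lemma coeffSum_cons (z : ℕ × ℤ) (L : List (ℕ × ℤ)) :
    coeffSum (z :: L) = z.2 + coeffSum L := by simp [coeffSum]

/-- Lists of pairs `(x, u)` with decreasing indices `1 ≤ x ≤ N` and coefficients `0 < |u| ≤ M`. -/
structure Admissible (N M : ℕ) (L : List (ℕ × ℤ)) : Prop where
  mem : ∀ z ∈ L, 1 ≤ z.1 ∧ z.1 ≤ N ∧ z.2 ≠ 0 ∧ |z.2| ≤ (M : ℤ)
  sorted : L.Pairwise fun z w => w.1 < z.1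

lemma Admissible.tail {N M : ℕ} {z : ℕ × ℤ} {L : List (ℕ × ℤ)} (h : Admissible N M (z :: L)) :
    Admissible N M L :=
  ⟨fun w hw => h.mem w (List.mem_cons_of_mem _ hw), (List.pairwise_cons.1 h.sorted).2⟩

/-- The first index of `L` has `a x` much smaller than `y`. -/
def Isolated (a : ℕ → ℝ) (G y : ℝ) : List (ℕ × ℤ) → Prop
  | [] => True
  | w :: _ => G * a w.1 < y

/-- The weighted sum is not much smaller than its leading element. -/
def NonNull (a : ℕ → ℝ) : List (ℕ × ℤ) → Prop
  | [] => False
  | w :: L => a w.1 ≤ 2 * |weightedSum a (w :: L)|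

open Classical in
/-- The number of final segments which are non-null and isolated from their predecessor, where `y`
plays the role of the predecessor of the whole list. -/
noncomputable def level (a : ℕ → ℝ) (G : ℝ) : ℝ → List (ℕ × ℤ) → ℕ
  | _, [] => 0
  | y, w :: L => (if Isolated a G y (w :: L) ∧ NonNull a (w :: L) then 1 else 0) +
      level a G (a w.1) L

/-- The level of the list without its first entry. -/
noncomputable def tailLevel (a : ℕ → ℝ) (G : ℝ) : List (ℕ × ℤ) → ℕ
  | [] => 0
  | w :: L => level a G (a w.1) L

open Classical in
lemma level_eq (a : ℕ → ℝ) (G y : ℝ) (L : List (ℕ × ℤ)) :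
    level a G y L = (if Isolated a G y L ∧ NonNull a L then 1 else 0) + tailLevel a G L := by
  cases L with
  | nil => simp [level, tailLevel, NonNull]
  | cons w L => simp [level, tailLevel]

/-- The remainder of the list is isolated from the first entry. -/
def TailIsolated (a : ℕ → ℝ) (G : ℝ) : List (ℕ × ℤ) → Prop
  | [] => True
  | w :: L => Isolated a G (a w.1) L

/-- The parameters of the counting problem. -/
structure CountingData (a : ℕ → ℝ) (c T Λ : ℝ) (k N M W : ℕ) : Prop where
  one_lt : 1 < c
  pos : 0 < a 1
  growth : ∀ n, 1 ≤ n → c * a n ≤ a (n + 1)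
  one_le_N : 1 ≤ N
  one_le_M : 1 ≤ M
  T_nonneg : 0 ≤ T
  coeff : 2 * M + 1 ≤ W * N
  window : ∀ (s : Finset ℕ) (lo : ℝ), (∀ x ∈ s, 1 ≤ x ∧ lo ≤ a x ∧ a x ≤ Λ * lo) → s.card ≤ W
  ratio : 8 * k * M ≤ Λ
  ratio_T : 6 * T ≤ Λ * a 1
  short : 2 * (T / a 1) + 2 ≤ W
  short_diff : c / (c - 1) + 1 ≤ W

/-! ### Elementary counting of integers and of lists by their heads. -/

lemma card_int_le {S : Finset ℤ} {z δ : ℝ} {W : ℕ} (h : ∀ u ∈ S, |(u : ℝ) - z| ≤ δ)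
    (hδ : 2 * δ + 1 ≤ W) : S.card ≤ W := by
  rcases S.eq_empty_or_nonempty with rfl | ⟨u₀, hu₀⟩
  · simp
  have hsub : S ⊆ Finset.Icc ⌈z - δ⌉ ⌊z + δ⌋ := by
    intro u hu
    have := abs_le.1 (h u hu)
    rw [Finset.mem_Icc, Int.ceil_le, Int.le_floor]
    constructor <;> linarith
  have h0 := Finset.mem_Icc.1 (hsub hu₀)
  have h1 := Finset.card_le_card hsub
  rw [Int.card_Icc] at h1
  have h2 : ((⌊z + δ⌋ + 1 - ⌈z - δ⌉).toNat : ℝ) ≤ W := by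
    have : ((⌊z + δ⌋ + 1 - ⌈z - δ⌉).toNat : ℤ) = ⌊z + δ⌋ + 1 - ⌈z - δ⌉ :=
      Int.toNat_of_nonneg (by omega)
    have h3 : ((⌊z + δ⌋ + 1 - ⌈z - δ⌉).toNat : ℝ) = ⌊z + δ⌋ + 1 - ⌈z - δ⌉ := by exact_mod_cast this
    rw [h3]
    have := Int.floor_le (z + δ)
    have := Int.le_ceil (z - δ)
    linarith
  exact h1.trans (by exact_mod_cast h2)

/-- Lists are counted from the top: index, coefficient, then tail. The factor `e` carries a saving
such as `N ^ p` without division in `ℕ`. -/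
lemma card_mul_le_of_heads {S : Finset (List (ℕ × ℤ))} (n m e b : ℕ) (hne : ∀ L ∈ S, L ≠ [])
    (hX : ∀ X : Finset ℕ, (∀ x ∈ X, ∃ u L, (x, u) :: L ∈ S) → X.card ≤ n)
    (hU : ∀ x, ∀ U : Finset ℤ, (∀ u ∈ U, ∃ L, (x, u) :: L ∈ S) → U.card ≤ m)
    (hb : ∀ x u, ∀ S' : Finset (List (ℕ × ℤ)), (∀ L ∈ S', (x, u) :: L ∈ S) → S'.card * e ≤ b) :
    S.card * e ≤ n * m * b := by
  classical
  let H : Finset (ℕ × ℤ) := S.image fun L => L.headD (0, 0)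
  let X : Finset ℕ := H.image Prod.fst
  have hmem : ∀ z ∈ H, ∃ L, z :: L ∈ S := by
    intro z hz
    obtain ⟨L, hL, rfl⟩ := Finset.mem_image.1 hz
    cases L with
    | nil => exact absurd rfl (hne _ hL)
    | cons w L => exact ⟨L, hL⟩
  have hXn : X.card ≤ n := hX X (by
    intro x hx
    obtain ⟨z, hz, rfl⟩ := Finset.mem_image.1 hx
    obtain ⟨L, hL⟩ := hmem z hz
    exact ⟨z.2, L, hL⟩)
  have hHm : H.card ≤ m * X.card := by
    refine Finset.card_le_mul_card_image H m ?_
    intro x _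
    have : (H.filter fun z => z.1 = x).card = ((H.filter fun z => z.1 = x).image Prod.snd).card := by
      rw [Finset.card_image_of_injOn]
      intro z hz w hw hzw
      simp only [Finset.coe_filter, Set.mem_ofPred_eq] at hz hw
      exact Prod.ext (hz.2.trans hw.2.symm) hzw
    rw [this]
    refine hU x _ ?_
    intro u hu
    obtain ⟨z, hz, rfl⟩ := Finset.mem_image.1 hu
    obtain ⟨hz1, rfl⟩ := Finset.mem_filter.1 hz
    exact hmem z hz1
  have hS : S.card * e = ∑ z ∈ H, (S.filter fun L => L.headD (0, 0) = z).card * e := by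
    rw [← Finset.sum_mul, ← Finset.card_eq_sum_card_image]
  have hz : ∀ z ∈ H, (S.filter fun L => L.headD (0, 0) = z).card * e ≤ b := by
    intro z _
    have hc : ∀ L ∈ S.filter (fun L => L.headD (0, 0) = z), z :: L.tail = L := by
      intro L hL
      obtain ⟨hL1, rfl⟩ := Finset.mem_filter.1 hL
      cases L with
      | nil => exact absurd rfl (hne _ hL1)
      | cons w L => rfl
    have : (S.filter fun L => L.headD (0, 0) = z).card =
        ((S.filter fun L => L.headD (0, 0) = z).image List.tail).card := by
      rw [Finset.card_image_of_injOn]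
      intro L hL L' hL' h
      rw [← hc L hL, ← hc L' hL']
      exact congrArg _ h
    rw [this]
    refine hb z.1 z.2 _ ?_
    intro L hL
    obtain ⟨L', hL', rfl⟩ := Finset.mem_image.1 hL
    have := hc L' hL'
    rw [this]
    exact (Finset.mem_filter.1 hL').1
  calc S.card * e ≤ H.card * b := by
        rw [hS]; simpa using Finset.sum_le_card_nsmul H _ b hz
    _ ≤ (m * X.card) * b := by gcongr
    _ ≤ (m * n) * b := by gcongr
    _ = n * m * b := by ring

/-! ### Size of the linear forms, and local counts of indices and coefficients. -/

namespace CountingData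

variable {a : ℕ → ℝ} {c T Λ : ℝ} {k N M W : ℕ}

lemma a_pos (h : CountingData a c T Λ k N M W) {n : ℕ} (hn : 1 ≤ n) : 0 < a n := by
  induction n, hn using Nat.le_induction with
  | base => exact h.pos
  | succ n hn ih => exact (mul_pos (one_pos.trans h.one_lt) ih).trans_le (h.growth n hn)

lemma mul_le_of_lt (h : CountingData a c T Λ k N M W) {m n : ℕ} (hm : 1 ≤ m) (hmn : m < n) :
    c * a m ≤ a n := by
  induction n, hmn using Nat.le_induction with
  | base => exact h.growth m hm
  | succ n hn ih =>
    have h1 : 1 ≤ n := hm.trans (by omega)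
    have := h.growth n h1
    have := h.a_pos h1
    nlinarith [h.one_lt]

lemma a_le (h : CountingData a c T Λ k N M W) {m n : ℕ} (hm : 1 ≤ m) (hmn : m ≤ n) :
    a m ≤ a n := by
  rcases hmn.eq_or_lt with rfl | hmn
  · rfl
  have := h.mul_le_of_lt hm hmn
  have := h.a_pos hm
  nlinarith [h.one_lt]

lemma abs_weightedSum_le (h : CountingData a c T Λ k N M W) {L : List (ℕ × ℤ)} {n : ℕ}
    (hL : Admissible N M L) (hn : ∀ z ∈ L, z.1 ≤ n) :
    |weightedSum a L| ≤ L.length * M * a n := by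
  induction L with
  | nil => simp
  | cons z L ih =>
    rw [weightedSum_cons, List.length_cons]
    have h1 := ih hL.tail fun w hw => hn w (List.mem_cons_of_mem _ hw)
    obtain ⟨hz1, -, -, hzM⟩ := hL.mem z List.mem_cons_self
    have h2 : |(z.2 : ℝ) * a z.1| ≤ M * a n := by
      rw [abs_mul, abs_of_pos (h.a_pos hz1)]
      have : |(z.2 : ℝ)| ≤ M := by exact_mod_cast hzM
      have := h.a_le hz1 (hn z List.mem_cons_self)
      have := (h.a_pos hz1).le
      gcongr
    refine (abs_add_le _ _).trans ?_
    push_cast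
    linarith

lemma abs_weightedSum_cons_le (h : CountingData a c T Λ k N M W) {z : ℕ × ℤ} {L : List (ℕ × ℤ)}
    (hL : Admissible N M (z :: L)) (hk : L.length + 1 ≤ k) :
    |weightedSum a (z :: L)| ≤ k * M * a z.1 := by
  have hz1 := (hL.mem z List.mem_cons_self).1
  refine (h.abs_weightedSum_le hL (n := z.1) ?_).trans ?_
  · intro w hw
    rcases List.mem_cons.1 hw with rfl | hw
    · rfl
    · exact ((List.pairwise_cons.1 hL.sorted).1 w hw).le
  · have : ((z :: L).length : ℝ) ≤ k := by exact_mod_cast hk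
    have := (h.a_pos hz1).le
    gcongr

/-- This is the reason for the gap factor `2kM`: a sum of at most `k` terms is at most `kM` times
its leading `a_x`, hence less than half of the predecessor. -/
lemma abs_weightedSum_le_of_isolated (h : CountingData a c T Λ k N M W) {L : List (ℕ × ℤ)} {y : ℝ}
    (hL : Admissible N M L) (hk : L.length ≤ k) (hi : Isolated a (2 * k * M) y L) (hy : 0 ≤ y) :
    |weightedSum a L| ≤ y / 2 := by
  cases L with
  | nil => simp; linarith
  | cons z L =>
    have := h.abs_weightedSum_cons_le hL hk
    simp only [Isolated] at hi
    linarith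

lemma one_le_W (h : CountingData a c T Λ k N M W) : 1 ≤ W := by
  rcases Nat.eq_zero_or_pos W with h0 | h0
  · have := h.coeff; simp [h0] at this
  · exact h0

lemma card_coeff_le (h : CountingData a c T Λ k N M W) {U : Finset ℤ}
    (hU : ∀ u ∈ U, |u| ≤ (M : ℤ)) : U.card ≤ W * N := by
  have hsub : U ⊆ Finset.Icc (-(M : ℤ)) M := fun u hu => Finset.mem_Icc.2 (abs_le.1 (hU u hu))
  have := Finset.card_le_card hsub
  rw [Int.card_Icc] at this
  have := h.coeff
  omega

lemma card_index_le {X : Finset ℕ} (hX : ∀ x ∈ X, 1 ≤ x ∧ x ≤ N) : X.card ≤ N := by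
  have hsub : X ⊆ Finset.Icc 1 N := fun u hu => Finset.mem_Icc.2 (hX u hu)
  simpa using Finset.card_le_card hsub

/-- A non-null sum determines its leading index up to `W` choices: its value lies within `T` of `A`
and is comparable with `a x` up to the factor `kM`. -/
lemma card_nonNull_le (h : CountingData a c T Λ k N M W) {X : Finset ℕ} {A : ℝ}
    (hX : ∀ x ∈ X, 1 ≤ x ∧ ∃ v : ℝ, a x ≤ 2 * |v| ∧ |v| ≤ k * M * a x ∧ |v - A| ≤ T) :
    X.card ≤ W := by
  have hT := h.T_nonneg
  -- If `|A| ≥ 2T`, then `|v|` is comparable with `|A|`; otherwise `|v| < 3T`, and all `a x` lie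
  -- between `a 1` and `6T`.
  rcases le_or_gt (2 * T) |A| with hA | hA
  · refine h.window X (|A| / (2 * k * M)) fun x hx => ?_
    obtain ⟨hx1, v, hv1, hv2, hv3⟩ := hX x hx
    have hax := h.a_pos hx1
    have h1 : |A| ≤ |v| + T := by
      have := abs_sub_abs_le_abs_sub A v
      rw [abs_sub_comm] at this
      linarith
    have h2 : |v| ≤ |A| + T := by
      have := abs_sub_abs_le_abs_sub v A
      linarith
    have hM : (1 : ℝ) ≤ M := by exact_mod_cast h.one_le_M
    have hk : 0 < (k : ℝ) * M := by
      by_contra hk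
      have : (k : ℝ) * M * a x ≤ 0 := mul_nonpos_of_nonpos_of_nonneg (not_lt.1 hk) hax.le
      linarith
    refine ⟨hx1, ?_, ?_⟩
    · rw [div_le_iff₀ (by linarith)]
      nlinarith
    · have h3 : a x ≤ 4 * |A| := by linarith
      calc a x ≤ 4 * |A| := h3
        _ = 8 * k * M * (|A| / (2 * k * M)) := by
          have : (k : ℝ) ≠ 0 := by rintro h0; simp [h0] at hk
          field_simp; ring
        _ ≤ Λ * (|A| / (2 * k * M)) := by
          gcongr
          exact h.ratio
  · refine h.window X (a 1) fun x hx => ?_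
    obtain ⟨hx1, v, hv1, hv2, hv3⟩ := hX x hx
    have h2 : |v| ≤ |A| + T := by
      have := abs_sub_abs_le_abs_sub v A
      linarith
    refine ⟨hx1, h.a_le le_rfl hx1, ?_⟩
    have := h.ratio_T
    linarith

lemma card_near_le (h : CountingData a c T Λ k N M W) {X : Finset ℕ} {y : ℝ} (hk : 1 ≤ k)
    (hX : ∀ x ∈ X, 1 ≤ x ∧ a x ≤ y ∧ y ≤ 2 * k * M * a x) : X.card ≤ W := by
  have hk' : (1 : ℝ) ≤ k := by exact_mod_cast hk
  have hM : (1 : ℝ) ≤ M := by exact_mod_cast h.one_le_M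
  have hkM : (1 : ℝ) ≤ k * M := one_le_mul_of_one_le_of_one_le hk' hM
  refine h.window X (y / (2 * k * M)) fun x hx => ?_
  obtain ⟨hx1, h1, h2⟩ := hX x hx
  have hax := h.a_pos hx1
  refine ⟨hx1, ?_, ?_⟩
  · rw [div_le_iff₀ (by linarith)]
    linarith
  · calc a x ≤ 4 * y := by linarith
      _ = 8 * k * M * (y / (2 * k * M)) := by field_simp; ring
      _ ≤ Λ * (y / (2 * k * M)) := by
        have := h.ratio
        have : 0 ≤ y := hax.le.trans h1
        gcongr

lemma card_near_ge (h : CountingData a c T Λ k N M W) {X : Finset ℕ} {y : ℝ} (hk : 1 ≤ k)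
    (hX : ∀ x ∈ X, 1 ≤ x ∧ y ≤ a x ∧ a x ≤ 2 * k * M * y) : X.card ≤ W := by
  refine h.window X y fun x hx => ?_
  obtain ⟨hx1, h1, h2⟩ := hX x hx
  refine ⟨hx1, h1, h2.trans ?_⟩
  have hk' : (1 : ℝ) ≤ k := by exact_mod_cast hk
  have hM : (1 : ℝ) ≤ M := by exact_mod_cast h.one_le_M
  have hkM : (1 : ℝ) ≤ k * M := one_le_mul_of_one_le_of_one_le hk' hM
  have hax := h.a_pos hx1
  have hy : 0 < y := by
    by_contra hy
    have : 2 * k * M * y ≤ 0 := mul_nonpos_of_nonneg_of_nonpos (by linarith) (not_lt.1 hy)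
    linarith
  have := h.ratio
  have : 2 * k * M ≤ Λ := by linarith
  gcongr

/-- Dividing by `a x ≥ a 1` leaves an interval of half-length at most `T / a 1 + 1 / 2` for `u`. -/
lemma card_coeff_le_of_near (h : CountingData a c T Λ k N M W) {U : Finset ℤ} {x : ℕ} {A : ℝ}
    (hx : 1 ≤ x) (hU : ∀ u ∈ U, |(u : ℝ) * a x - A| ≤ T + a x / 2) : U.card ≤ W := by
  have hax := h.a_pos hx
  refine card_int_le (z := A / a x) (δ := T / a 1 + 1 / 2) (fun u hu => ?_) ?_
  · have h1 := hU u hu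
    have h2 : (u : ℝ) - A / a x = (u * a x - A) / a x := by field_simp
    rw [h2, abs_div, abs_of_pos hax, div_le_iff₀ hax]
    refine h1.trans ?_
    have h3 : T ≤ T / a 1 * a x := by
      rw [div_mul_eq_mul_div, le_div_iff₀ h.pos]
      exact mul_le_mul_of_nonneg_left (h.a_le le_rfl hx) h.T_nonneg
    linarith
  · have := h.short
    linarith

end CountingData

/-- For a factor of `4`, every list in the set may be assumed to fall under the same case of two
dichotomies. -/
lemma card_le_of_four_parts {α : Type*} {S : Finset α} {e b : ℕ} (P Q : α → Prop)
    (h : ∀ S' ⊆ S, (∀ s ∈ S', ∀ t ∈ S', (P s ↔ P t) ∧ (Q s ↔ Q t)) → S'.card * e ≤ b) :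
    S.card * e ≤ 4 * b := by
  classical
  have h1 := Finset.card_filter_add_card_filter_not (s := S) P
  have h2 := Finset.card_filter_add_card_filter_not (s := S.filter P) Q
  have h3 := Finset.card_filter_add_card_filter_not (s := S.filter fun s => ¬ P s) Q
  have k1 := h ((S.filter P).filter Q)
    ((Finset.filter_subset _ _).trans (Finset.filter_subset _ _)) (by simp +contextual)
  have k2 := h ((S.filter P).filter fun s => ¬ Q s)
    ((Finset.filter_subset _ _).trans (Finset.filter_subset _ _)) (by simp +contextual)
  have k3 := h ((S.filter fun s => ¬ P s).filter Q)
    ((Finset.filter_subset _ _).trans (Finset.filter_subset _ _)) (by simp +contextual)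
  have k4 := h ((S.filter fun s => ¬ P s).filter fun s => ¬ Q s)
    ((Finset.filter_subset _ _).trans (Finset.filter_subset _ _)) (by simp +contextual)
  rw [← h1, ← h2, ← h3]
  linarith

/-! ### Lists of given level whose sum is near a target. -/

namespace CountingData

variable {a : ℕ → ℝ} {c T Λ : ℝ} {k N M W : ℕ}

/-- Induction from the top, with target `A - u * a x` for the tail. The second conclusion treats
lists that continue the block of their predecessor `y`: the leading index is then confined near `y`,
which gains one more factor `N`. That gain pays for the free coefficient of the predecessor. -/
theorem card_near_target_le (h : CountingData a c T Λ k N M W) {r : ℕ} (hr : r ≤ k) (y A : ℝ)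
    (p : ℕ) (S : Finset (List (ℕ × ℤ)))
    (hS : ∀ L ∈ S, L.length = r ∧ Admissible N M L ∧ |weightedSum a L - A| ≤ T ∧
      level a (2 * k * M) y L = p) :
    ((∀ L ∈ S, Isolated a (2 * k * M) y L) → S.card * N ^ p ≤ (4 * W ^ 2) ^ r * N ^ r) ∧
    ((∀ L ∈ S, ¬ Isolated a (2 * k * M) y L ∧ ∀ w L', L = w :: L' → a w.1 ≤ y) →
      S.card * N ^ (p + 1) ≤ (4 * W ^ 2) ^ r * N ^ r) := by
  classical
  set G : ℝ := 2 * k * M with hG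
  induction r generalizing y A p S with
  | zero =>
    have hnil : ∀ L ∈ S, L = [] := fun L hL => List.length_eq_zero_iff.1 (hS L hL).1
    refine ⟨fun _ => ?_, fun hI => ?_⟩
    · rcases S.eq_empty_or_nonempty with rfl | ⟨L, hL⟩
      · simp
      have hp := (hS L hL).2.2.2
      rw [hnil L hL] at hp
      have : S.card ≤ 1 := Finset.card_le_one.2 fun x hx z hz => (hnil x hx).trans (hnil z hz).symm
      simp only [level] at hp
      subst hp
      simpa using this
    · rcases S.eq_empty_or_nonempty with rfl | ⟨L, hL⟩
      · simp
      have := (hI L hL).1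
      rw [hnil L hL] at this
      exact absurd trivial this
  | succ r ih =>
    have hk1 : 1 ≤ k := by omega
    have hN := h.one_le_N
    have hW := h.one_le_W
    -- the bound for a set of lists with constant flags
    have core : ∀ (p' n : ℕ) (S' : Finset (List (ℕ × ℤ))), S' ⊆ S →
        (∀ s ∈ S', ∀ t ∈ S', (NonNull a s ↔ NonNull a t) ∧
          (TailIsolated a G s ↔ TailIsolated a G t)) →
        (∀ L ∈ S', tailLevel a G L = p') →
        (∀ X : Finset ℕ, (∀ x ∈ X, ∃ u L, (x, u) :: L ∈ S') → X.card ≤ n) →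
        S'.card * N ^ p' ≤ n * W * ((4 * W ^ 2) ^ r * N ^ r) := by
      intro p' n S' hsub hflag hp' hn
      have hne : ∀ L ∈ S', L ≠ [] := by
        rintro L hL rfl
        simpa using (hS _ (hsub hL)).1
      have hx1 : ∀ x u L, (x, u) :: L ∈ S' → 1 ≤ x := fun x u L hL =>
        ((hS _ (hsub hL)).2.1.mem _ List.mem_cons_self).1
      have htail : ∀ x u, ∀ S'' : Finset (List (ℕ × ℤ)), (∀ L ∈ S'', (x, u) :: L ∈ S') →
          ∀ L ∈ S'', L.length = r ∧ Admissible N M L ∧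
            |weightedSum a L - (A - u * a x)| ≤ T ∧ level a G (a x) L = p' := by
        intro x u S'' hS'' L hL
        obtain ⟨h1, h2, h3, -⟩ := hS _ (hsub (hS'' L hL))
        refine ⟨by simpa using h1, h2.tail, ?_, hp' _ (hS'' L hL)⟩
        rw [weightedSum_cons] at h3
        rwa [show weightedSum a L - (A - u * a x) = u * a x + weightedSum a L - A by ring]
      -- With an isolated tail, `u * a x` is within `T + a x / 2` of `A`, so `u` has `W` choices.
      by_cases hT : ∀ L ∈ S', TailIsolated a G L
      · refine card_mul_le_of_heads n W _ _ hne hn ?_ ?_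
        · intro x U hU
          rcases U.eq_empty_or_nonempty with rfl | ⟨u₀, hu₀⟩
          · simp
          obtain ⟨L₀, hL₀⟩ := hU u₀ hu₀
          refine h.card_coeff_le_of_near (A := A) (hx1 _ _ _ hL₀) fun u hu => ?_
          obtain ⟨L, hL⟩ := hU u hu
          obtain ⟨h1, h2, h3, -⟩ := hS _ (hsub hL)
          have h4 := h.abs_weightedSum_le_of_isolated h2.tail
            (by rw [List.length_cons] at h1; omega) (hT _ hL) (h.a_pos (hx1 _ _ _ hL)).le
          rw [weightedSum_cons] at h3
          have h5 := abs_sub_abs_le_abs_sub ((u : ℝ) * a x - A) (-weightedSum a L)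
          rw [abs_neg, show (u : ℝ) * a x - A - -weightedSum a L =
            u * a x + weightedSum a L - A by ring] at h5
          simp only at h3 h4 h5
          linarith
        · intro x u S'' hS''
          exact (ih (by omega) (a x) (A - u * a x) p' S'' (htail x u S'' hS'')).1
            fun L hL => hT _ (hS'' L hL)
      · push Not at hT
        obtain ⟨L₀, hL₀, hL₀'⟩ := hT
        have hT : ∀ L ∈ S', ¬ TailIsolated a G L := fun L hL =>
          ((hflag L hL L₀ hL₀).2).not.2 hL₀'
        -- Here `u` is free, with `W * N` choices, and the surplus `N` is recovered from the second
        -- conclusion for the tail.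
        have := card_mul_le_of_heads (S := S') n (W * N) (N ^ (p' + 1)) _ hne hn (by
          intro x U hU
          refine h.card_coeff_le fun u hu => ?_
          obtain ⟨L, hL⟩ := hU u hu
          exact ((hS _ (hsub hL)).2.1.mem _ List.mem_cons_self).2.2.2) (by
          intro x u S'' hS''
          refine (ih (by omega) (a x) (A - u * a x) p' S'' (htail x u S'' hS'')).2
            fun L hL => ⟨hT _ (hS'' L hL), ?_⟩
          rintro w L' rfl
          have hA := (hS _ (hsub (hS'' _ hL))).2.1
          exact h.a_le (hA.tail.mem _ List.mem_cons_self).1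
            ((List.pairwise_cons.1 hA.sorted).1 w List.mem_cons_self).le)
        refine Nat.le_of_mul_le_mul_right (c := N) ?_ hN
        calc S'.card * N ^ p' * N = S'.card * N ^ (p' + 1) := by ring
          _ ≤ _ := this
          _ = _ := by ring
    have hlev : ∀ L ∈ S, (if Isolated a G y L ∧ NonNull a L then 1 else 0) + tailLevel a G L = p :=
      fun L hL => by rw [← level_eq]; exact (hS L hL).2.2.2
    have hpow : 4 * (W * W * ((4 * W ^ 2) ^ r * N ^ r) * N) = (4 * W ^ 2) ^ (r + 1) * N ^ (r + 1) := by
      ring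
    refine ⟨fun hI => ?_, fun hI => ?_⟩
    · rw [← hpow]
      refine card_le_of_four_parts (NonNull a) (TailIsolated a G) fun S' hsub hflag => ?_
      rcases S'.eq_empty_or_nonempty with rfl | ⟨L₀, hL₀⟩
      · simp
      by_cases hnn : NonNull a L₀
      -- A counted segment uses one unit of level, matched by its leading index having `W` choices
      -- in place of `N`.
      · have hp : ∀ L ∈ S', tailLevel a G L = p - 1 ∧ 1 ≤ p := by
          intro L hL
          have := hlev L (hsub hL)
          rw [if_pos ⟨hI L (hsub hL), (hflag L hL L₀ hL₀).1.2 hnn⟩] at this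
          omega
        have := core (p - 1) W S' hsub hflag (fun L hL => (hp L hL).1) (by
          intro X hX
          refine h.card_nonNull_le (A := A) fun x hx => ?_
          obtain ⟨u, L, hL⟩ := hX x hx
          obtain ⟨h1, h2, h3, -⟩ := hS _ (hsub hL)
          refine ⟨(h2.mem _ List.mem_cons_self).1, weightedSum a ((x, u) :: L),
            (hflag _ hL L₀ hL₀).1.2 hnn, h.abs_weightedSum_cons_le h2 ?_, h3⟩
          rw [List.length_cons] at h1
          omega)
        calc S'.card * N ^ p = S'.card * N ^ (p - 1) * N := by
              rw [mul_assoc, ← pow_succ, Nat.sub_add_cancel (hp L₀ hL₀).2]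
          _ ≤ _ := Nat.mul_le_mul_right N this
      · have := core p N S' hsub hflag (fun L hL => by
          have := hlev L (hsub hL)
          rwa [if_neg (fun h => hnn ((hflag L hL L₀ hL₀).1.1 h.2)), zero_add] at this) (by
          intro X hX
          refine card_index_le fun x hx => ?_
          obtain ⟨u, L, hL⟩ := hX x hx
          have := (hS _ (hsub hL)).2.1.mem _ List.mem_cons_self
          exact ⟨this.1, this.2.1⟩)
        calc S'.card * N ^ p ≤ _ := this
          _ = 1 * W * ((4 * W ^ 2) ^ r * N ^ r) * N := by ring
          _ ≤ _ := by gcongr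
    · rw [← hpow]
      refine card_le_of_four_parts (NonNull a) (TailIsolated a G) fun S' hsub hflag => ?_
      have := core p W S' hsub hflag (fun L hL => by
        have := hlev L (hsub hL)
        rwa [if_neg (fun h => (hI L (hsub hL)).1 h.1), zero_add] at this) (by
        intro X hX
        refine h.card_near_le (y := y) hk1 fun x hx => ?_
        obtain ⟨u, L, hL⟩ := hX x hx
        refine ⟨((hS _ (hsub hL)).2.1.mem _ List.mem_cons_self).1,
          (hI _ (hsub hL)).2 _ _ rfl, ?_⟩
        exact not_lt.1 (hI _ (hsub hL)).1)
      calc S'.card * N ^ (p + 1) = S'.card * N ^ p * N := by ring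
        _ ≤ _ := Nat.mul_le_mul_right N this

end CountingData

/-! ### Lists of given level with vanishing coefficient sum. -/

/-- Counting from the bottom: the tail is fixed before the head, so that it may constrain the
leading index and coefficient. -/
lemma card_le_of_tails {S : Finset (List (ℕ × ℤ))} (n m b : ℕ) (hne : ∀ L ∈ S, L ≠ [])
    (hX : ∀ L, ∀ X : Finset ℕ, (∀ x ∈ X, ∃ u, (x, u) :: L ∈ S) → X.card ≤ n)
    (hU : ∀ x L, ∀ U : Finset ℤ, (∀ u ∈ U, (x, u) :: L ∈ S) → U.card ≤ m)
    (hb : ∀ S' : Finset (List (ℕ × ℤ)), (∀ L ∈ S', ∃ z, z :: L ∈ S) → S'.card ≤ b) :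
    S.card ≤ n * m * b := by
  classical
  have hcons : ∀ L ∈ S, L.headD (0, 0) :: L.tail = L := by
    intro L hL
    cases L with
    | nil => exact absurd rfl (hne _ hL)
    | cons w L => rfl
  have h1 : S.card ≤ (n * m) * (S.image List.tail).card := by
    refine Finset.card_le_mul_card_image S _ fun L _ => ?_
    have h2 : (S.filter fun L' => L'.tail = L).card * 1 ≤ n * m * 1 := by
      refine card_mul_le_of_heads n m 1 1 (fun L' hL' => hne L' (Finset.mem_filter.1 hL').1) ?_ ?_ ?_
      · intro X hX'
        refine hX L X fun x hx => ?_
        obtain ⟨u, L', hL'⟩ := hX' x hx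
        obtain ⟨h3, h4⟩ := Finset.mem_filter.1 hL'
        exact ⟨u, by rwa [← h4]⟩
      · intro x U hU'
        refine hU x L U fun u hu => ?_
        obtain ⟨L', hL'⟩ := hU' u hu
        obtain ⟨h3, h4⟩ := Finset.mem_filter.1 hL'
        rwa [← h4]
      · intro x u S' hS'
        rw [mul_one, Finset.card_le_one]
        intro L₁ h₁ L₂ h₂
        have e₁ := (Finset.mem_filter.1 (hS' _ h₁)).2
        have e₂ := (Finset.mem_filter.1 (hS' _ h₂)).2
        exact e₁.trans e₂.symm
    simpa using h2
  have h2 : (S.image List.tail).card ≤ b := hb _ fun L hL => by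
    obtain ⟨L', hL', rfl⟩ := Finset.mem_image.1 hL
    exact ⟨_, by rw [hcons L' hL']; exact hL'⟩
  exact h1.trans (Nat.mul_le_mul_left _ h2)

namespace CountingData

variable {a : ℕ → ℝ} {c T Λ : ℝ} {k N M W : ℕ}

/-- Nullity places `u * a x` within `a x / 2` of minus the tail sum. -/
lemma card_coeff_le_of_null (h : CountingData a c T Λ k N M W) {U : Finset ℤ} {x : ℕ}
    {L : List (ℕ × ℤ)} (hx : 1 ≤ x) (hU : ∀ u ∈ U, ¬ NonNull a ((x, u) :: L)) : U.card ≤ W := by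
  refine h.card_coeff_le_of_near (A := -weightedSum a L) hx fun u hu => ?_
  have h1 := hU u hu
  simp only [NonNull, weightedSum_cons, not_le] at h1
  rw [sub_neg_eq_add]
  linarith [h.T_nonneg]

/-- Given the tail `L`, few indices `x` can precede it without `L` being isolated from `x`. -/
lemma card_heads_le (h : CountingData a c T Λ k N M W) (hk : 1 ≤ k) {L : List (ℕ × ℤ)}
    {X : Finset ℕ} (hX : ∀ x ∈ X, (∃ u, Admissible N M ((x, u) :: L)) ∧
      ¬ Isolated a (2 * k * M) (a x) L) : X.card ≤ W := by
  cases L with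
  | nil =>
    rcases X.eq_empty_or_nonempty with rfl | ⟨x, hx⟩
    · simp
    · exact absurd trivial (hX x hx).2
  | cons w L =>
    refine h.card_near_ge (y := a w.1) hk fun x hx => ?_
    obtain ⟨⟨u, hA⟩, hI⟩ := hX x hx
    refine ⟨(hA.mem _ List.mem_cons_self).1, ?_, not_lt.1 hI⟩
    exact h.a_le (hA.tail.mem _ List.mem_cons_self).1
      ((List.pairwise_cons.1 hA.sorted).1 w List.mem_cons_self).le

/-- The leading coefficient contributes `W * N` if arbitrary (`ν = 1`) and `W` if the list is null
(`ν = 0`). An index opening a block has `N` choices, one continuing a block has `W`. In each of the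
three cases of the induction the powers of `N` add up to `r + p + ν`. -/
theorem card_tailLevel_le (h : CountingData a c T Λ k N M W) {r : ℕ} (hr : r ≤ k) (p ν : ℕ)
    (hν : ν ≤ 1) (S : Finset (List (ℕ × ℤ)))
    (hS : ∀ L ∈ S, L.length = r ∧ Admissible N M L ∧ tailLevel a (2 * k * M) L = p ∧
      (ν = 0 → ¬ NonNull a L)) :
    S.card ≤ (4 * W ^ 2) ^ r * N ^ (r + p + ν) := by
  classical
  set G : ℝ := 2 * k * M with hG
  have hN := h.one_le_N
  have hW := h.one_le_W
  induction r generalizing p ν S with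
  | zero =>
    have hnil : ∀ L ∈ S, L = [] := fun L hL => List.length_eq_zero_iff.1 (hS L hL).1
    have : S.card ≤ 1 := Finset.card_le_one.2 fun x hx z hz => (hnil x hx).trans (hnil z hz).symm
    simpa using this.trans (Nat.one_le_pow (p + ν) N hN)
  | succ r ih =>
    have hk1 : 1 ≤ k := by omega
    rw [← Nat.mul_one S.card]
    have hpow : (4 * W ^ 2) ^ (r + 1) * N ^ (r + 1 + p + ν) =
      4 * (W * W * (4 * W ^ 2) ^ r * N ^ (r + 1 + p + ν)) := by ring
    rw [hpow]
    refine card_le_of_four_parts (fun L => NonNull a L.tail) (TailIsolated a G)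
      fun S' hsub hflag => ?_
    rw [Nat.mul_one]
    rcases S'.eq_empty_or_nonempty with rfl | ⟨L₀, hL₀⟩
    · simp
    have hne : ∀ L ∈ S', L ≠ [] := by
      rintro L hL rfl
      simpa using (hS _ (hsub hL)).1
    have hcoeff : ∀ x L, ∀ U : Finset ℤ, (∀ u ∈ U, (x, u) :: L ∈ S') → U.card ≤ W * N ^ ν := by
      intro x L U hU
      rcases U.eq_empty_or_nonempty with rfl | ⟨u₀, hu₀⟩
      · simp
      have hx : 1 ≤ x := ((hS _ (hsub (hU u₀ hu₀))).2.1.mem _ List.mem_cons_self).1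
      interval_cases ν
      · rw [pow_zero, mul_one]
        exact h.card_coeff_le_of_null hx fun u hu => (hS _ (hsub (hU u hu))).2.2.2 rfl
      · rw [pow_one]
        exact h.card_coeff_le fun u hu =>
          ((hS _ (hsub (hU u hu))).2.1.mem _ List.mem_cons_self).2.2.2
    have key : ∀ (n p' ν' : ℕ), ν' ≤ 1 →
        (∀ z L, z :: L ∈ S' → tailLevel a G L = p' ∧ (ν' = 0 → ¬ NonNull a L)) →
        (∀ L, ∀ X : Finset ℕ, (∀ x ∈ X, ∃ u, (x, u) :: L ∈ S') → X.card ≤ n) →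
        S'.card ≤ n * (W * N ^ ν) * ((4 * W ^ 2) ^ r * N ^ (r + p' + ν')) := by
      intro n p' ν' hν' hp' hn
      refine card_le_of_tails n _ _ hne hn hcoeff fun S'' hS'' => ?_
      refine ih (by omega) p' ν' hν' S'' fun L hL => ?_
      obtain ⟨z, hz⟩ := hS'' L hL
      obtain ⟨h1, h2, -, -⟩ := hS _ (hsub hz)
      exact ⟨by simpa using h1, h2.tail, hp' z L hz⟩
    have hlev : ∀ z L, z :: L ∈ S' →
        (if Isolated a G (a z.1) L ∧ NonNull a L then 1 else 0) + tailLevel a G L = p := by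
      intro z L hL
      rw [← level_eq]
      exact (hS _ (hsub hL)).2.2.1
    by_cases hT : TailIsolated a G L₀
    -- Across a cut the index is free. A non-null tail lowers `p` by one and has `ν' = 1`; a null
    -- tail keeps `p` and has `ν' = 0`.
    · have hN' : ∀ L, ∀ X : Finset ℕ, (∀ x ∈ X, ∃ u, (x, u) :: L ∈ S') → X.card ≤ N := by
        intro L X hX
        refine card_index_le fun x hx => ?_
        obtain ⟨u, hL⟩ := hX x hx
        have := (hS _ (hsub hL)).2.1.mem _ List.mem_cons_self
        exact ⟨this.1, this.2.1⟩
      have hT' : ∀ z L, z :: L ∈ S' → Isolated a G (a z.1) L := fun z L hL =>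
        (hflag _ hL _ hL₀).2.2 hT
      by_cases hnn : NonNull a L₀.tail
      · have hp : ∀ z L, z :: L ∈ S' → tailLevel a G L = p - 1 ∧ 1 ≤ p := by
          intro z L hL
          have := hlev z L hL
          rw [if_pos ⟨hT' z L hL, (hflag _ hL _ hL₀).1.2 hnn⟩] at this
          omega
        have h1p : 1 ≤ p := by
          cases L₀ with
          | nil => exact absurd rfl (hne _ hL₀)
          | cons z L => exact (hp z L hL₀).2
        calc S'.card ≤ _ := key N (p - 1) 1 le_rfl
              (fun z L hL => ⟨(hp z L hL).1, by simp⟩) hN'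
          _ = 1 * W * (4 * W ^ 2) ^ r * N ^ (r + 1 + p + ν) := by
            rw [show r + 1 + p + ν = 1 + ν + (r + (p - 1) + 1) by omega]
            ring
          _ ≤ _ := by gcongr
      · calc S'.card ≤ _ := key N p 0 (by omega) (fun z L hL => by
              have h1 := hlev z L hL
              have h2 := (hflag _ hL _ hL₀).1.not.2 hnn
              rw [if_neg fun h => h2 h.2, zero_add] at h1
              exact ⟨h1, fun _ => h2⟩) hN'
          _ = 1 * W * (4 * W ^ 2) ^ r * N ^ (r + 1 + p + ν) := by ring
          _ ≤ _ := by gcongr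
    · have hT' : ∀ z L, z :: L ∈ S' → ¬ Isolated a G (a z.1) L := fun z L hL =>
        (hflag _ hL _ hL₀).2.not.2 hT
      calc S'.card ≤ _ := key W p 1 le_rfl (fun z L hL => by
              have h1 := hlev z L hL
              rw [if_neg fun h => hT' z L hL h.1, zero_add] at h1
              exact ⟨h1, by simp⟩) (fun L X hX => h.card_heads_le hk1 fun x hx => by
                obtain ⟨u, hL⟩ := hX x hx
                exact ⟨⟨u, (hS _ (hsub hL)).2.1⟩, hT' (x, u) L hL⟩)
        _ = W * W * (4 * W ^ 2) ^ r * N ^ (r + 1 + p + ν) := by ring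

/-- An isolated tail is at most `a x / 2` and cannot cancel the leading term `|u| a x ≥ a x`. So a
null list has at least two terms in its first block. -/
lemma tail_of_null (h : CountingData a c T Λ k N M W) {z : ℕ × ℤ} {L : List (ℕ × ℤ)}
    (hk : L.length + 1 ≤ k) (hA : Admissible N M (z :: L)) (hnull : ¬ NonNull a (z :: L)) :
    ¬ Isolated a (2 * k * M) (a z.1) L := by
  intro hI
  apply hnull
  obtain ⟨hz1, -, hz0, -⟩ := hA.mem z List.mem_cons_self
  have hz := h.a_pos hz1
  have h1 := h.abs_weightedSum_le_of_isolated hA.tail (by omega) hI hz.le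
  have h2 : a z.1 ≤ |(z.2 : ℝ) * a z.1| := by
    rw [abs_mul, abs_of_pos hz]
    have : (1 : ℝ) ≤ |(z.2 : ℝ)| := by exact_mod_cast Int.one_le_abs hz0
    nlinarith
  have h3 := abs_sub_abs_le_abs_sub ((z.2 : ℝ) * a z.1) (-weightedSum a L)
  rw [abs_neg, sub_neg_eq_add] at h3
  rw [NonNull, weightedSum_cons]
  linarith

/-- Eliminating `v` by the zero sum gives `u` the multiplier `a x - a y ≥ (1 - 1/c) a x`, so nullity
still confines `u` to an interval of length `c / (c - 1)`. -/
lemma card_coeff_le_of_null_of_sum (h : CountingData a c T Λ k N M W) {U : Finset ℤ} {x y : ℕ}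
    {L : List (ℕ × ℤ)} (hy : 1 ≤ y) (hxy : y < x)
    (hU : ∀ u ∈ U, ∃ v : ℤ, ¬ NonNull a ((x, u) :: (y, v) :: L) ∧ u + (v + coeffSum L) = 0) :
    U.card ≤ W := by
  have hc := h.one_lt
  have hc1 : 0 < c - 1 := by linarith
  have hy0 := h.a_pos hy
  have hx0 := h.a_pos (hy.trans hxy.le)
  have hle := h.mul_le_of_lt hy hxy
  have hd : (c - 1) * a x ≤ c * (a x - a y) := by linarith
  have hd0 : 0 < a x - a y := by nlinarith
  refine card_int_le (z := (coeffSum L * a y - weightedSum a L) / (a x - a y))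
    (δ := c / (2 * (c - 1))) (fun u hu => ?_) ?_
  · obtain ⟨v, h1, h2⟩ := hU u hu
    have hv : (v : ℝ) = -u - coeffSum L := by
      have : v = -u - coeffSum L := by omega
      exact_mod_cast this
    simp only [NonNull, weightedSum_cons, not_le, hv] at h1
    have h3 : (u : ℝ) - (coeffSum L * a y - weightedSum a L) / (a x - a y) =
        (u * a x + ((-u - coeffSum L) * a y + weightedSum a L)) / (a x - a y) := by
      field_simp; ring
    rw [h3, abs_div, abs_of_pos hd0, div_le_div_iff₀ hd0 (by linarith)]
    nlinarith
  · have := h.short_diff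
    have h4 : 2 * (c / (2 * (c - 1))) = c / (c - 1) := by field_simp
    linarith

/-- Nullity and the zero sum are independent conditions on the first two coefficients, and by
`tail_of_null` the first two indices lie in one block. This saves one more `N` over the count of
null lists. -/
theorem card_null_sum_zero_le (h : CountingData a c T Λ k N M W) {r : ℕ} (hr : r ≤ k) (p : ℕ)
    (S : Finset (List (ℕ × ℤ)))
    (hS : ∀ L ∈ S, L.length = r ∧ Admissible N M L ∧ tailLevel a (2 * k * M) L = p ∧
      ¬ NonNull a L ∧ coeffSum L = 0 ∧ L ≠ []) :
    S.card * N ≤ (4 * W ^ 2) ^ r * N ^ (r + p) := by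
  classical
  set G : ℝ := 2 * k * M with hG
  have hN := h.one_le_N
  have hW := h.one_le_W
  have hform : ∀ L ∈ S, ∃ z w L', L = z :: w :: L' := by
    intro L hL
    obtain ⟨-, h2, -, -, h5, h6⟩ := hS L hL
    match L with
    | [] => exact absurd rfl h6
    | [z] =>
      have := (h2.mem z List.mem_cons_self).2.2.1
      simp [coeffSum] at h5
      exact absurd h5 this
    | z :: w :: L' => exact ⟨z, w, L', rfl⟩
  rcases S.eq_empty_or_nonempty with rfl | ⟨L₁, hL₁⟩
  · simp
  obtain ⟨z₁, w₁, L₁', rfl⟩ := hform L₁ hL₁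
  obtain ⟨s, rfl⟩ : ∃ s, r = s + 2 := ⟨L₁'.length, by have := (hS _ hL₁).1; simpa using this.symm⟩
  have hk1 : 1 ≤ k := by omega
  have hpow : (4 * W ^ 2) ^ (s + 2) * N ^ (s + 2 + p) =
    4 * (4 * W ^ 4 * (4 * W ^ 2) ^ s * N ^ (s + 2 + p)) := by ring
  rw [hpow]
  refine card_le_of_four_parts (fun L => NonNull a L.tail.tail) (fun L => TailIsolated a G L.tail)
    fun S' hsub hflag => ?_
  rcases S'.eq_empty_or_nonempty with rfl | ⟨L₀, hL₀⟩
  · simp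
  obtain ⟨z₀, w₀, L₀', rfl⟩ := hform L₀ (hsub hL₀)
  -- the second coefficient is determined by the others
  let φ : List (ℕ × ℤ) → List (ℕ × ℤ) := fun L => match L with
    | z :: w :: L' => z :: (w.1, 0) :: L'
    | L => L
  have hφ : (S'.image φ).card = S'.card := by
    refine Finset.card_image_of_injOn ?_
    intro L hL L' hL' heq
    have e₁ := (hS L (hsub hL)).2.2.2.2.1
    have e₂ := (hS L' (hsub hL')).2.2.2.2.1
    obtain ⟨z, w, L, rfl⟩ := hform L (hsub hL)
    obtain ⟨z', w', L', rfl⟩ := hform L' (hsub hL')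
    simp only [φ, List.cons.injEq, Prod.mk.injEq, and_true] at heq
    obtain ⟨rfl, h3, rfl⟩ := heq
    simp only [coeffSum_cons] at e₁ e₂
    have : w = w' := Prod.ext h3 (by omega)
    rw [this]
  have hmem : ∀ L ∈ S'.image φ, ∃ z y v L', L = z :: (y, 0) :: L' ∧ z :: (y, v) :: L' ∈ S' := by
    intro L hL
    obtain ⟨L', hL', rfl⟩ := Finset.mem_image.1 hL
    obtain ⟨z, w, L'', rfl⟩ := hform L' (hsub hL')
    exact ⟨z, w.1, w.2, L'', rfl, hL'⟩
  have hmem' : ∀ z w L', z :: w :: L' ∈ S'.image φ →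
      w.2 = 0 ∧ ∃ v, z :: (w.1, v) :: L' ∈ S' := by
    intro z w L' hL'
    obtain ⟨z', y, v, L'', h1, h2⟩ := hmem _ hL'
    simp only [List.cons.injEq] at h1
    obtain ⟨rfl, rfl, rfl⟩ := h1
    exact ⟨rfl, v, h2⟩
  have hlt : ∀ z w L', z :: w :: L' ∈ S' → 1 ≤ w.1 ∧ w.1 < z.1 ∧ w.1 ≤ N := by
    intro z w L' hL
    have hA := (hS _ (hsub hL)).2.1
    have := hA.tail.mem _ List.mem_cons_self
    exact ⟨this.1, (List.pairwise_cons.1 hA.sorted).1 w List.mem_cons_self, this.2.1⟩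
  have hnear : ∀ z w L', z :: w :: L' ∈ S' → ¬ Isolated a G (a z.1) (w :: L') := by
    intro z w L' hL
    obtain ⟨h1, h2, -, h3, -⟩ := hS _ (hsub hL)
    refine h.tail_of_null ?_ h2 h3
    simp only [List.length_cons] at h1 ⊢
    omega
  have hlev : ∀ z w L', z :: w :: L' ∈ S' →
      (if Isolated a G (a w.1) L' ∧ NonNull a L' then 1 else 0) + tailLevel a G L' = p := by
    intro z w L' hL
    have h1 := (hS _ (hsub hL)).2.2.1
    change level a G (a z.1) (w :: L') = p at h1
    -- The segment starting at the second entry is not isolated from the first, so it does not count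
    -- towards the level.
    rw [level_eq, if_neg fun h => hnear z w L' hL h.1, zero_add] at h1
    rw [← level_eq]
    exact h1
  have key : ∀ (n p' ν' : ℕ), ν' ≤ 1 →
      (∀ z w L, z :: w :: L ∈ S' → tailLevel a G L = p' ∧ (ν' = 0 → ¬ NonNull a L)) →
      (∀ L, ∀ X : Finset ℕ, (∀ y ∈ X, ∃ z v, z :: (y, v) :: L ∈ S') → X.card ≤ n) →
      S'.card ≤ W * W * (n * 1 * ((4 * W ^ 2) ^ s * N ^ (s + p' + ν'))) := by
    intro n p' ν' hν' hp' hn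
    rw [← hφ]
    -- `W` leading indices near the second one and `W` leading coefficients; below them, `n` second
    -- indices with the coefficient erased.
    refine card_le_of_tails W W _ ?_ ?_ ?_ ?_
    · rintro L hL rfl
      obtain ⟨_, _, _, _, h1, -⟩ := hmem _ hL
      simp at h1
    · intro L X hX
      match L with
      | [] =>
        rcases X.eq_empty_or_nonempty with rfl | ⟨x, hx⟩
        · simp
        obtain ⟨u, hu⟩ := hX x hx
        obtain ⟨_, _, _, _, h1, -⟩ := hmem _ hu
        simp at h1
      | w :: L =>
        refine h.card_near_ge (y := a w.1) hk1 fun x hx => ?_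
        obtain ⟨u, hu⟩ := hX x hx
        obtain ⟨-, v, hv⟩ := hmem' _ _ _ hu
        obtain ⟨h1, h2, -⟩ := hlt _ _ _ hv
        exact ⟨h1.trans h2.le, h.a_le h1 h2.le, not_lt.1 (hnear _ _ _ hv)⟩
    · intro x L U hU
      rcases U.eq_empty_or_nonempty with rfl | ⟨u₀, hu₀⟩
      · simp
      obtain ⟨z, y, v, L', h1, h2⟩ := hmem _ (hU u₀ hu₀)
      simp only [List.cons.injEq] at h1
      obtain ⟨rfl, rfl⟩ := h1
      obtain ⟨hy1, hyx, -⟩ := hlt _ _ _ h2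
      refine h.card_coeff_le_of_null_of_sum (L := L') hy1 hyx fun u hu => ?_
      obtain ⟨-, v, hv⟩ := hmem' _ _ _ (hU u hu)
      obtain ⟨-, -, -, h3, h4, -⟩ := hS _ (hsub hv)
      exact ⟨v, h3, by simpa using h4⟩
    · intro S'' hS''
      have hS2 : ∀ L ∈ S'', ∃ y L', L = (y, 0) :: L' ∧ ∃ z v, z :: (y, v) :: L' ∈ S' := by
        intro L hL
        obtain ⟨z, hz⟩ := hS'' L hL
        obtain ⟨z', y, v, L', h1, h2⟩ := hmem _ hz
        simp only [List.cons.injEq] at h1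
        obtain ⟨rfl, rfl⟩ := h1
        exact ⟨y, L', rfl, z, v, h2⟩
      refine card_le_of_tails n 1 _ ?_ ?_ ?_ ?_
      · rintro L hL rfl
        obtain ⟨_, _, h1, -⟩ := hS2 _ hL
        simp at h1
      · intro L X hX
        refine hn L X fun y hy => ?_
        obtain ⟨u, hu⟩ := hX y hy
        obtain ⟨y', L', h1, z, v, h2⟩ := hS2 _ hu
        simp only [List.cons.injEq, Prod.mk.injEq] at h1
        obtain ⟨⟨rfl, -⟩, rfl⟩ := h1
        exact ⟨z, v, h2⟩
      · intro x L U hU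
        have h0 : ∀ u ∈ U, u = 0 := by
          intro u hu
          obtain ⟨y', L', h1, -⟩ := hS2 _ (hU u hu)
          simp only [List.cons.injEq, Prod.mk.injEq] at h1
          exact h1.1.2
        exact Finset.card_le_one.2 fun u hu v hv => (h0 u hu).trans (h0 v hv).symm
      · intro S3 hS3
        refine h.card_tailLevel_le (by omega) p' ν' hν' S3 fun L hL => ?_
        obtain ⟨w, hw⟩ := hS3 L hL
        obtain ⟨y', L', h1, z, v, h2⟩ := hS2 _ hw
        simp only [List.cons.injEq] at h1
        obtain ⟨rfl, rfl⟩ := h1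
        obtain ⟨h3, h4, -⟩ := hS _ (hsub h2)
        exact ⟨by simpa using h3, h4.tail.tail, hp' _ _ _ h2⟩
  by_cases hT : Isolated a G (a w₀.1) L₀'
  · have hN' : ∀ L, ∀ X : Finset ℕ, (∀ y ∈ X, ∃ z v, z :: (y, v) :: L ∈ S') → X.card ≤ N := by
      intro L X hX
      refine card_index_le fun y hy => ?_
      obtain ⟨z, v, hL⟩ := hX y hy
      have := hlt _ _ _ hL
      exact ⟨this.1, this.2.2⟩
    have hT' : ∀ z w L, z :: w :: L ∈ S' → Isolated a G (a w.1) L := fun z w L hL =>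
      (hflag _ hL _ hL₀).2.2 hT
    by_cases hnn : NonNull a L₀'
    · have hp : ∀ z w L, z :: w :: L ∈ S' → tailLevel a G L = p - 1 ∧ 1 ≤ p := by
        intro z w L hL
        have := hlev z w L hL
        rw [if_pos ⟨hT' z w L hL, (hflag _ hL _ hL₀).1.2 hnn⟩] at this
        omega
      have h1p : 1 ≤ p := (hp _ _ _ hL₀).2
      calc S'.card * N ≤ _ := Nat.mul_le_mul_right N (key N (p - 1) 1 le_rfl
            (fun z w L hL => ⟨(hp z w L hL).1, by simp⟩) hN')
        _ = 1 * W ^ 2 * (4 * W ^ 2) ^ s * N ^ (s + 2 + p) := by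
          rw [show s + 2 + p = 2 + (s + (p - 1) + 1) by omega]
          ring
        _ ≤ _ := by gcongr <;> omega
    · calc S'.card * N ≤ _ := Nat.mul_le_mul_right N (key N p 0 (by omega) (fun z w L hL => by
            have h1 := hlev z w L hL
            have h2 := (hflag _ hL _ hL₀).1.not.2 hnn
            simp only [List.tail_cons] at h2
            rw [if_neg fun h => h2 h.2, zero_add] at h1
            exact ⟨h1, fun _ => h2⟩) hN')
        _ = 1 * W ^ 2 * (4 * W ^ 2) ^ s * N ^ (s + 2 + p) := by ring
        _ ≤ _ := by gcongr <;> omega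
  · have hT' : ∀ z w L, z :: w :: L ∈ S' → ¬ Isolated a G (a w.1) L := fun z w L hL =>
      (hflag _ hL _ hL₀).2.not.2 hT
    calc S'.card * N ≤ _ := Nat.mul_le_mul_right N (key W p 1 le_rfl (fun z w L hL => by
            have h1 := hlev z w L hL
            rw [if_neg fun h => hT' z w L hL h.1, zero_add] at h1
            exact ⟨h1, by simp⟩) (fun L X hX => h.card_heads_le hk1 fun y hy => by
              obtain ⟨z, v, hL⟩ := hX y hy
              exact ⟨⟨v, (hS _ (hsub hL)).2.1.tail⟩, hT' z (y, v) L hL⟩))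
      _ = 1 * W ^ 3 * (4 * W ^ 2) ^ s * N ^ (s + 2 + p) := by ring
      _ ≤ _ := by gcongr <;> omega

/-- A null list falls under `card_null_sum_zero_le`. For a non-null one the whole list is a counted
segment, so `tailLevel = p - 1`, and the zero sum determines the leading coefficient from the tail;
this removes a factor `N` from the bound `N ^ (r + p)` of `card_tailLevel_le`. -/
theorem card_sum_zero_le (h : CountingData a c T Λ k N M W) {r : ℕ} (hr : r ≤ k) (y : ℝ) (p : ℕ)
    (S : Finset (List (ℕ × ℤ)))
    (hS : ∀ L ∈ S, L.length = r ∧ Admissible N M L ∧ level a (2 * k * M) y L = p ∧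
      Isolated a (2 * k * M) y L ∧ coeffSum L = 0 ∧ L ≠ []) :
    S.card * N ≤ 4 * ((4 * W ^ 2) ^ r * N ^ (r + p)) := by
  classical
  have hN := h.one_le_N
  have hW := h.one_le_W
  refine card_le_of_four_parts (NonNull a) (fun L => True) fun S' hsub hflag => ?_
  rcases S'.eq_empty_or_nonempty with rfl | ⟨L₀, hL₀⟩
  · simp
  obtain ⟨s, rfl⟩ : ∃ s, r = s + 1 := by
    obtain ⟨h1, -, -, -, -, h2⟩ := hS _ (hsub hL₀)
    have := List.length_pos_iff.2 h2
    exact ⟨r - 1, by omega⟩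
  have hlev : ∀ L ∈ S', (if NonNull a L then 1 else 0) + tailLevel a (2 * k * M) L = p := by
    intro L hL
    obtain ⟨-, -, h1, h2, -⟩ := hS L (hsub hL)
    rw [level_eq] at h1
    simpa [h2] using h1
  by_cases hnn : NonNull a L₀
  · have hp : ∀ L ∈ S', tailLevel a (2 * k * M) L = p - 1 ∧ 1 ≤ p := by
      intro L hL
      have := hlev L hL
      rw [if_pos ((hflag L hL _ hL₀).1.2 hnn)] at this
      omega
    have h1p : 1 ≤ p := (hp _ hL₀).2
    have hne : ∀ L ∈ S', L ≠ [] := fun L hL => (hS L (hsub hL)).2.2.2.2.2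
    have hone : ∀ x L, ∀ U : Finset ℤ, (∀ u ∈ U, (x, u) :: L ∈ S') → U.card ≤ 1 := by
      intro x L U hU
      refine Finset.card_le_one.2 fun u hu v hv => ?_
      have h1 := (hS _ (hsub (hU u hu))).2.2.2.2.1
      have h2 := (hS _ (hsub (hU v hv))).2.2.2.2.1
      simp only [coeffSum_cons] at h1 h2
      omega
    rw [show (4 * W ^ 2) ^ (s + 1) * N ^ (s + 1 + p) =
      4 * (W ^ 2 * (4 * W ^ 2) ^ s * N ^ (s + 1 + p)) by ring]
    refine card_le_of_four_parts (fun L => NonNull a L.tail) (TailIsolated a (2 * k * M))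
      fun S2 hsub2 hflag2 => ?_
    rcases S2.eq_empty_or_nonempty with rfl | ⟨L₁, hL₁⟩
    · simp
    have hlev2 : ∀ z L, z :: L ∈ S2 →
        (if Isolated a (2 * k * M) (a z.1) L ∧ NonNull a L then 1 else 0) +
          tailLevel a (2 * k * M) L = p - 1 := by
      intro z L hL
      rw [← level_eq]
      exact (hp _ (hsub2 hL)).1
    have key : ∀ (n q ν : ℕ), ν ≤ 1 →
        (∀ z L, z :: L ∈ S2 → tailLevel a (2 * k * M) L = q ∧ (ν = 0 → ¬ NonNull a L)) →
        (∀ L, ∀ X : Finset ℕ, (∀ x ∈ X, ∃ u, (x, u) :: L ∈ S2) → X.card ≤ n) →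
        S2.card ≤ n * 1 * ((4 * W ^ 2) ^ s * N ^ (s + q + ν)) := by
      intro n q ν hν hq hn
      refine card_le_of_tails n 1 _ (fun L hL => hne L (hsub2 hL)) hn
        (fun x L U hU => hone x L U fun u hu => hsub2 (hU u hu)) fun S3 hS3 => ?_
      refine h.card_tailLevel_le (by omega) q ν hν S3 fun L hL => ?_
      obtain ⟨z, hz⟩ := hS3 L hL
      obtain ⟨h1, h2, -⟩ := hS _ (hsub (hsub2 hz))
      exact ⟨by simpa using h1, h2.tail, hq z L hz⟩
    by_cases hT : TailIsolated a (2 * k * M) L₁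
    · have hN' : ∀ L, ∀ X : Finset ℕ, (∀ x ∈ X, ∃ u, (x, u) :: L ∈ S2) → X.card ≤ N := by
        intro L X hX
        refine card_index_le fun x hx => ?_
        obtain ⟨u, hL⟩ := hX x hx
        have := (hS _ (hsub (hsub2 hL))).2.1.mem _ List.mem_cons_self
        exact ⟨this.1, this.2.1⟩
      by_cases hn2 : NonNull a L₁.tail
      · have hq : ∀ z L, z :: L ∈ S2 → tailLevel a (2 * k * M) L = p - 2 ∧ 2 ≤ p := by
          intro z L hL
          have := hlev2 z L hL
          rw [if_pos ⟨(hflag2 _ hL _ hL₁).2.2 hT, (hflag2 _ hL _ hL₁).1.2 hn2⟩] at this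
          omega
        have h2p : 2 ≤ p := by
          cases L₁ with
          | nil => exact absurd rfl (hne _ (hsub2 hL₁))
          | cons z L => exact (hq z L hL₁).2
        calc S2.card * N ≤ _ := Nat.mul_le_mul_right N (key N (p - 2) 1 le_rfl
              (fun z L hL => ⟨(hq z L hL).1, by simp⟩) hN')
          _ = 1 ^ 2 * (4 * W ^ 2) ^ s * N ^ (s + 1 + p) := by
            rw [show s + 1 + p = 2 + (s + (p - 2) + 1) by omega]
            ring
          _ ≤ _ := by gcongr
      · calc S2.card * N ≤ _ := Nat.mul_le_mul_right N (key N (p - 1) 0 (by omega)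
              (fun z L hL => by
                have h1 := hlev2 z L hL
                have h2 := (hflag2 _ hL _ hL₁).1.not.2 hn2
                rw [if_neg fun h => h2 h.2, zero_add] at h1
                exact ⟨h1, fun _ => h2⟩) hN')
          _ = 1 ^ 2 * (4 * W ^ 2) ^ s * N ^ (s + 1 + p) := by
            rw [show s + 1 + p = 2 + (s + (p - 1)) by omega]
            ring
          _ ≤ _ := by gcongr
    · have hT' : ∀ z L, z :: L ∈ S2 → ¬ Isolated a (2 * k * M) (a z.1) L := fun z L hL =>
        (hflag2 _ hL _ hL₁).2.not.2 hT
      calc S2.card * N ≤ _ := Nat.mul_le_mul_right N (key W (p - 1) 1 le_rfl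
              (fun z L hL => by
                have h1 := hlev2 z L hL
                rw [if_neg fun h => hT' z L hL h.1, zero_add] at h1
                exact ⟨h1, by simp⟩)
              (fun L X hX => h.card_heads_le (by omega) fun x hx => by
                obtain ⟨u, hL⟩ := hX x hx
                exact ⟨⟨u, (hS _ (hsub (hsub2 hL))).2.1⟩, hT' (x, u) L hL⟩))
        _ = W ^ 1 * (4 * W ^ 2) ^ s * N ^ (s + 1 + p) := by
          rw [show s + 1 + p = 1 + (s + (p - 1) + 1) by omega]
          ring
        _ ≤ _ := by gcongr; omega
  · refine h.card_null_sum_zero_le hr p S' fun L hL => ?_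
    obtain ⟨h1, h2, -, -, h3, h4⟩ := hS L (hsub hL)
    have h5 := (hflag L hL _ hL₀).1.not.2 hnn
    have h6 := hlev L hL
    rw [if_neg h5, zero_add] at h6
    exact ⟨h1, h2, h6, h5, h3, h4⟩

end CountingData

/-! ### From tuples to lists, and the count of close pairs. -/

/-- The list of pairs `(x i, u i)` with `u i ≠ 0`, ordered by decreasing `x i`. -/
def pairList {k : ℕ} (u : Fin k → ℤ) (x : Fin k → ℕ) : List (ℕ × ℤ) :=
  (((Finset.univ.filter fun i => u i ≠ 0).image x).sort (· ≥ ·)).map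
    fun y => (y, ∑ i with x i = y, u i)

section pairList

variable {k N M : ℕ} {u : Fin k → ℤ} {x : Fin k → ℕ}

lemma sum_filter_eq_of_injective (hx : Function.Injective x) (i : Fin k) :
    ∑ j with x j = x i, u j = u i := by
  rw [Finset.sum_eq_single i]
  · intro j hj hji
    exact absurd (hx (Finset.mem_filter.1 hj).2) hji
  · simp

lemma mem_pairList_iff (hx : Function.Injective x) {z : ℕ × ℤ} :
    z ∈ pairList u x ↔ ∃ i, u i ≠ 0 ∧ z = (x i, u i) := by
  simp only [pairList, List.mem_map, Finset.mem_sort, Finset.mem_image, Finset.mem_filter,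
    Finset.mem_univ, true_and]
  constructor
  · rintro ⟨y, ⟨i, hi, rfl⟩, rfl⟩
    exact ⟨i, hi, by rw [sum_filter_eq_of_injective hx]⟩
  · rintro ⟨i, hi, rfl⟩
    exact ⟨x i, ⟨i, hi, rfl⟩, by rw [sum_filter_eq_of_injective hx]⟩

lemma length_pairList (hx : Function.Injective x) :
    (pairList u x).length = (Finset.univ.filter fun i => u i ≠ 0).card := by
  rw [pairList, List.length_map, Finset.length_sort, Finset.card_image_of_injective _ hx]

lemma sum_map_pairList {R : Type*} [AddCommMonoid R] (hx : Function.Injective x)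
    (g : ℕ × ℤ → R) (hg : ∀ y, g (y, 0) = 0) :
    ((pairList u x).map g).sum = ∑ i, g (x i, u i) := by
  have h1 : ((pairList u x).map g).sum =
      ∑ y ∈ (Finset.univ.filter fun i => u i ≠ 0).image x, g (y, ∑ i with x i = y, u i) := by
    rw [pairList, List.map_map, Finset.sum_eq_multiset_sum, ← Finset.sort_eq _ (· ≥ ·)]
    rfl
  rw [h1, Finset.sum_image hx.injOn, Finset.sum_filter]
  refine Finset.sum_congr rfl fun i _ => ?_
  rw [sum_filter_eq_of_injective hx]
  split_ifs with h
  · rfl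
  · rw [not_not.1 h, hg]

lemma admissible_pairList (hx : Function.Injective x) (hxN : ∀ i, 1 ≤ x i ∧ x i ≤ N)
    (hu : ∀ i, |u i| ≤ (M : ℤ)) : Admissible N M (pairList u x) := by
  refine ⟨fun z hz => ?_, ?_⟩
  · obtain ⟨i, hi, rfl⟩ := (mem_pairList_iff hx).1 hz
    exact ⟨(hxN i).1, (hxN i).2, hi, hu i⟩
  · rw [pairList, List.pairwise_map]
    exact Finset.sortedGT_sort _ |>.pairwise

end pairList

lemma level_le_length (a : ℕ → ℝ) (G y : ℝ) (L : List (ℕ × ℤ)) : level a G y L ≤ L.length := by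
  induction L generalizing y with
  | nil => simp [level]
  | cons w L ih =>
    rw [level, List.length_cons]
    have := ih (a w.1)
    split_ifs <;> omega

/-- A tuple is recovered from its support, the position in `L` of each supported entry, and the `k -
r` indices with zero coefficient, which are free. -/
lemma card_pairList_fiber_le {k N r : ℕ} {L : List (ℕ × ℤ)}
    (P : Finset ((Fin k → ℤ) × (Fin k → ℕ)))
    (hP : ∀ z ∈ P, (∀ i, 1 ≤ z.2 i ∧ z.2 i ≤ N) ∧ Function.Injective z.2 ∧ pairList z.1 z.2 = L ∧
      L.length = r) : P.card ≤ 2 ^ k * (k + 1) ^ k * N ^ (k - r) := by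
  classical
  let T := (Finset.univ.powersetCard r : Finset (Finset (Fin k))).sigma fun s =>
    Fintype.piFinset fun i => if i ∈ s then Finset.range (k + 1) else Finset.Icc 1 N
  let φ : (Fin k → ℤ) × (Fin k → ℕ) → Σ _ : Finset (Fin k), Fin k → ℕ := fun z =>
    ⟨Finset.univ.filter fun i => z.1 i ≠ 0,
      fun i => if z.1 i ≠ 0 then L.idxOf (z.2 i, z.1 i) else z.2 i⟩
  have hcard : T.card ≤ 2 ^ k * (k + 1) ^ k * N ^ (k - r) := by
    rw [Finset.card_sigma]
    have hs : ∀ s ∈ (Finset.univ.powersetCard r : Finset (Finset (Fin k))),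
        (Fintype.piFinset fun i => if i ∈ s then Finset.range (k + 1) else Finset.Icc 1 N).card ≤
          (k + 1) ^ k * N ^ (k - r) := by
      intro s hs
      have hsr := (Finset.mem_powersetCard.1 hs).2
      have hrk : r ≤ k := by rw [← hsr]; simpa using Finset.card_le_univ s
      rw [Fintype.card_piFinset]
      have : ∀ i, (if i ∈ s then Finset.range (k + 1) else Finset.Icc 1 N).card =
          if i ∈ s then k + 1 else N := by
        intro i; split_ifs <;> simp
      simp only [this]
      rw [Finset.prod_ite, Finset.prod_const, Finset.prod_const]
      have h1 : (Finset.univ.filter fun i => i ∈ s) = s := by ext; simp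
      have h2 : (Finset.univ.filter fun i => i ∉ s) = sᶜ := by ext; simp
      rw [h1, h2, Finset.card_compl, hsr, Fintype.card_fin]
      gcongr
      omega
    refine (Finset.sum_le_card_nsmul _ _ _ hs).trans ?_
    rw [smul_eq_mul, mul_assoc]
    gcongr
    rw [Finset.card_powersetCard, Finset.card_univ, Fintype.card_fin]
    exact Nat.choose_le_two_pow k r
  refine le_trans ?_ hcard
  refine Finset.card_le_card_of_injOn φ ?_ ?_
  · intro z hz
    obtain ⟨h1, h2, h3, h4⟩ := hP z hz
    have hlen := length_pairList (u := z.1) h2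
    rw [h3] at hlen
    simp only [SetLike.mem_coe, T, φ, Finset.mem_sigma, Finset.mem_powersetCard,
      Finset.subset_univ, true_and, Fintype.mem_piFinset, Finset.mem_filter, Finset.mem_univ]
    refine ⟨by omega, fun i => ?_⟩
    by_cases hi : z.1 i = 0
    · simp [hi, h1 i]
    · simp only [ne_eq, hi, not_false_eq_true, if_true, Finset.mem_range]
      have h5 : L.idxOf (z.2 i, z.1 i) ≤ L.length := List.idxOf_le_length
      have h6 := Finset.card_le_univ (Finset.univ.filter fun i => z.1 i ≠ 0)
      rw [Fintype.card_fin] at h6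
      omega
  · intro z hz w hw hzw
    obtain ⟨h1, h2, h3, h4⟩ := hP z hz
    obtain ⟨k1, k2, k3, k4⟩ := hP w hw
    simp only [φ, Sigma.mk.injEq, heq_eq_eq] at hzw
    obtain ⟨hs, hf⟩ := hzw
    have hiff : ∀ i, z.1 i ≠ 0 ↔ w.1 i ≠ 0 := by
      intro i
      have := Finset.ext_iff.1 hs i
      simpa using this
    have hmain : ∀ i, (z.2 i, z.1 i) = (w.2 i, w.1 i) := by
      intro i
      have hfi := congrFun hf i
      by_cases hi : z.1 i = 0
      · have hi' : w.1 i = 0 := by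
          by_contra hw0
          exact (hiff i).2 hw0 hi
        simp only [hi, hi', ne_eq, not_true_eq_false, if_false] at hfi
        rw [hi, hi', hfi]
      · have hi' := (hiff i).1 hi
        simp only [ne_eq, hi, hi', not_false_eq_true, if_true] at hfi
        refine (List.idxOf_inj ?_).1 hfi
        rw [← h3]
        exact (mem_pairList_iff h2).2 ⟨i, hi, rfl⟩
    refine Prod.ext (funext fun i => ?_) (funext fun i => ?_)
    · exact congrArg Prod.snd (hmain i)
    · exact congrArg Prod.fst (hmain i)

/-- The `N ^ (k - r)` tuples over a list of length `r` complete `N ^ r` to `N ^ k`, so bounds for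
lists of all lengths combine. -/
lemma card_mul_le_of_pairList {k N : ℕ} (P : Finset ((Fin k → ℤ) × (Fin k → ℕ))) (e b : ℕ)
    (hP : ∀ z ∈ P, (∀ i, 1 ≤ z.2 i ∧ z.2 i ≤ N) ∧ Function.Injective z.2)
    (hb : ∀ r ≤ k, ∀ S : Finset (List (ℕ × ℤ)),
      (∀ L ∈ S, L.length = r ∧ ∃ z ∈ P, L = pairList z.1 z.2) → S.card * e ≤ b * N ^ r) :
    P.card * e ≤ (k + 1) * (2 ^ k * (k + 1) ^ k) * b * N ^ k := by
  classical
  have hlen : ∀ z ∈ P, (pairList z.1 z.2).length ≤ k := by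
    intro z hz
    rw [length_pairList (hP z hz).2]
    simpa using Finset.card_le_univ (Finset.univ.filter fun i => z.1 i ≠ 0)
  have h1 : P.card = ∑ r ∈ Finset.range (k + 1),
      (P.filter fun z => (pairList z.1 z.2).length = r).card := by
    refine Finset.card_eq_sum_card_fiberwise fun z hz => ?_
    have := hlen z hz
    simp only [Finset.coe_range, Set.mem_Iio]
    omega
  have h2 : ∀ r ∈ Finset.range (k + 1), (P.filter fun z => (pairList z.1 z.2).length = r).card * e ≤
      2 ^ k * (k + 1) ^ k * b * N ^ k := by
    intro r hr
    have hrk : r ≤ k := by have := Finset.mem_range.1 hr; omega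
    set Q := P.filter fun z => (pairList z.1 z.2).length = r with hQ
    have h3 : Q.card ≤ 2 ^ k * (k + 1) ^ k * N ^ (k - r) *
        (Q.image fun z => pairList z.1 z.2).card := by
      refine Finset.card_le_mul_card_image Q _ fun L hL => ?_
      refine card_pairList_fiber_le (L := L) _ fun z hz => ?_
      obtain ⟨h4, h5⟩ := Finset.mem_filter.1 hz
      obtain ⟨h6, h7⟩ := Finset.mem_filter.1 h4
      exact ⟨(hP z h6).1, (hP z h6).2, h5, h5 ▸ h7⟩
    have h4 := hb r hrk (Q.image fun z => pairList z.1 z.2) fun L hL => by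
      obtain ⟨z, hz, rfl⟩ := Finset.mem_image.1 hL
      obtain ⟨h6, h7⟩ := Finset.mem_filter.1 hz
      exact ⟨h7, z, h6, rfl⟩
    calc Q.card * e ≤ 2 ^ k * (k + 1) ^ k * N ^ (k - r) *
          (Q.image fun z => pairList z.1 z.2).card * e := Nat.mul_le_mul_right e h3
      _ = 2 ^ k * (k + 1) ^ k * N ^ (k - r) *
          ((Q.image fun z => pairList z.1 z.2).card * e) := by ring
      _ ≤ 2 ^ k * (k + 1) ^ k * N ^ (k - r) * (b * N ^ r) := Nat.mul_le_mul_left _ h4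
      _ = 2 ^ k * (k + 1) ^ k * b * N ^ k := by
        have : N ^ k = N ^ (k - r) * N ^ r := by rw [← pow_add, Nat.sub_add_cancel hrk]
        rw [this]
        ring
  rw [h1, Finset.sum_mul]
  refine (Finset.sum_le_card_nsmul _ _ _ h2).trans (le_of_eq ?_)
  rw [Finset.card_range, smul_eq_mul]
  ring

/-- The linear form `∑ u_i a_{x_i}`. -/
def frequency {k : ℕ} (a : ℕ → ℝ) (z : (Fin k → ℤ) × (Fin k → ℕ)) : ℝ :=
  ∑ i, (z.1 i : ℝ) * a (z.2 i)

namespace CountingData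

variable {a : ℕ → ℝ} {c T Λ : ℝ} {k N M W : ℕ}

/-- The level-`p` count `N ^ (k + p - 1)` and the near-target count `N ^ (k - q)` are complementary:
for `p ≤ q` their product is at most `N ^ (2k - 1)`, and the case `q ≤ p` is symmetric. -/
theorem card_pairs_le (h : CountingData a c T Λ k N M W)
    (P : Finset ((Fin k → ℤ) × (Fin k → ℕ)))
    (hP : ∀ z ∈ P, z.1 ≠ 0 ∧ ∑ i, z.1 i = 0 ∧ (∀ i, |z.1 i| ≤ (M : ℤ)) ∧
      (∀ i, 1 ≤ z.2 i ∧ z.2 i ≤ N) ∧ Function.Injective z.2)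
    (Q : Finset (((Fin k → ℤ) × (Fin k → ℕ)) × ((Fin k → ℤ) × (Fin k → ℕ))))
    (hQ : ∀ z ∈ Q, z.1 ∈ P ∧ z.2 ∈ P ∧ |frequency a z.1 - frequency a z.2| ≤ T) :
    Q.card * N ≤ (k + 1) ^ 2 * ((k + 1) * (2 ^ k * (k + 1) ^ k) * (4 * (4 * W ^ 2) ^ k)) ^ 2 *
      N ^ (2 * k) := by
  classical
  have hN := h.one_le_N
  have hW := h.one_le_W
  -- A fictitious predecessor so large that every list is isolated from it.
  set Y : ℝ := 2 * k * M * a N + 1 with hY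
  set lev : (Fin k → ℤ) × (Fin k → ℕ) → ℕ := fun z => level a (2 * k * M) Y (pairList z.1 z.2)
  set E := (k + 1) * (2 ^ k * (k + 1) ^ k) * (4 * (4 * W ^ 2) ^ k) with hE
  have hV : ∀ r ≤ k, (4 * W ^ 2) ^ r ≤ (4 * W ^ 2) ^ k := fun r hr => by
    gcongr
    have : 1 ≤ W ^ 2 := Nat.one_le_pow _ _ hW
    omega
  have hadm : ∀ z ∈ P, Admissible N M (pairList z.1 z.2) := fun z hz => by
    obtain ⟨-, -, h3, h4, h5⟩ := hP z hz
    exact admissible_pairList h5 h4 h3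
  have hiso : ∀ z ∈ P, Isolated a (2 * k * M) Y (pairList z.1 z.2) := fun z hz => by
    have hA := hadm z hz
    match hL : pairList z.1 z.2 with
    | [] => trivial
    | w :: L =>
      rw [hL] at hA
      obtain ⟨h1, h2, -⟩ := hA.mem w List.mem_cons_self
      have := h.a_le h1 h2
      have h3 : (2 * k * M : ℝ) * a w.1 ≤ 2 * k * M * a N := by gcongr
      simp only [Isolated]
      linarith
  have hws : ∀ z ∈ P, weightedSum a (pairList z.1 z.2) = frequency a z := fun z hz =>
    sum_map_pairList (hP z hz).2.2.2.2 _ (by simp)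
  have hcs : ∀ z ∈ P, coeffSum (pairList z.1 z.2) = 0 := fun z hz => by
    rw [coeffSum, sum_map_pairList (hP z hz).2.2.2.2 _ (by simp)]
    exact (hP z hz).2.1
  have hne : ∀ z ∈ P, pairList z.1 z.2 ≠ [] := fun z hz => by
    obtain ⟨h1, -, -, -, h5⟩ := hP z hz
    obtain ⟨i, hi⟩ := Function.ne_iff.1 h1
    exact List.ne_nil_of_mem ((mem_pairList_iff h5).2 ⟨i, hi, rfl⟩)
  have hA : ∀ p, (P.filter fun z => lev z = p).card * N ≤ E * N ^ (k + p) := by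
    intro p
    refine (card_mul_le_of_pairList (N := N) (P.filter fun z => lev z = p) N
      (4 * (4 * W ^ 2) ^ k * N ^ p) (fun z hz => ?_) fun r hr S hS => ?_).trans (le_of_eq ?_)
    · have := hP z (Finset.mem_filter.1 hz).1
      exact this.2.2.2
    · refine (h.card_sum_zero_le hr Y p S fun L hL => ?_).trans ?_
      · obtain ⟨h1, z, hz, rfl⟩ := hS L hL
        obtain ⟨hz, h2⟩ := Finset.mem_filter.1 hz
        exact ⟨h1, hadm z hz, h2, hiso z hz, hcs z hz, hne z hz⟩
      · calc 4 * ((4 * W ^ 2) ^ r * N ^ (r + p)) ≤ 4 * ((4 * W ^ 2) ^ k * N ^ (r + p)) := by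
              gcongr 4 * (?_ * _)
              exact hV r hr
          _ = _ := by ring
    · rw [hE]; ring
  have hB : ∀ p A, (P.filter fun z => lev z = p ∧ |frequency a z - A| ≤ T).card * N ^ p ≤
      E * N ^ k := by
    intro p A
    refine (card_mul_le_of_pairList (P.filter fun z => lev z = p ∧ |frequency a z - A| ≤ T) (N ^ p)
      (4 * (4 * W ^ 2) ^ k) (fun z hz => ?_) fun r hr S hS => ?_)
    · have := hP z (Finset.mem_filter.1 hz).1
      exact this.2.2.2
    · refine ((h.card_near_target_le hr Y A p S fun L hL => ?_).1 fun L hL => ?_).trans ?_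
      · obtain ⟨h1, z, hz, rfl⟩ := hS L hL
        obtain ⟨hz, h2, h3⟩ := Finset.mem_filter.1 hz
        exact ⟨h1, hadm z hz, by rwa [hws z hz], h2⟩
      · obtain ⟨h1, z, hz, rfl⟩ := hS L hL
        exact hiso z (Finset.mem_filter.1 hz).1
      · gcongr ?_ * _
        have := hV r hr
        omega
  have hlevk : ∀ z ∈ P, lev z < k + 1 := fun z hz => by
    have h1 := level_le_length a (2 * k * M) Y (pairList z.1 z.2)
    have h2 := length_pairList (u := z.1) (hP z hz).2.2.2.2
    have h3 := Finset.card_le_univ (Finset.univ.filter fun i => z.1 i ≠ 0)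
    rw [Fintype.card_fin] at h3
    simp only [lev]
    omega
  have hpair : ∀ p q, p ≤ q → ∀ R : Finset (((Fin k → ℤ) × (Fin k → ℕ)) × ((Fin k → ℤ) × (Fin k → ℕ))),
      (∀ z ∈ R, z.1 ∈ P ∧ z.2 ∈ P ∧ |frequency a z.1 - frequency a z.2| ≤ T ∧
        lev z.1 = p ∧ lev z.2 = q) → R.card * N ≤ E ^ 2 * N ^ (2 * k) := by
    intro p q hpq R hR
    have h1 : R.card = ∑ z ∈ P.filter (fun z => lev z = p), (R.filter fun w => w.1 = z).card := by
      refine Finset.card_eq_sum_card_fiberwise fun z hz => ?_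
      obtain ⟨h2, -, -, h3, -⟩ := hR z hz
      exact Finset.mem_coe.2 (Finset.mem_filter.2 ⟨h2, h3⟩)
    have h2 : ∀ z ∈ P.filter (fun z => lev z = p), (R.filter fun w => w.1 = z).card * N ^ q ≤
        E * N ^ k := by
      intro z hz
      refine (Nat.mul_le_mul_right _ ?_).trans (hB q (frequency a z))
      refine Finset.card_le_card_of_injOn Prod.snd (fun w hw => ?_) fun w hw w' hw' hww => ?_
      · obtain ⟨hw1, rfl⟩ := Finset.mem_filter.1 hw
        obtain ⟨-, h3, h4, -, h5⟩ := hR w hw1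
        rw [abs_sub_comm] at h4
        exact Finset.mem_coe.2 (Finset.mem_filter.2 ⟨h3, h5, h4⟩)
      · have e1 := (Finset.mem_filter.1 hw).2
        have e2 := (Finset.mem_filter.1 hw').2
        exact Prod.ext (e1.trans e2.symm) hww
    have h3 : R.card * N ^ q ≤ (P.filter fun z => lev z = p).card * (E * N ^ k) := by
      rw [h1, Finset.sum_mul]
      simpa using Finset.sum_le_card_nsmul _ _ _ h2
    -- The first frequency is chosen by the zero-sum count `hA p`, the second by `hB q` with the
    -- first as target.
    refine Nat.le_of_mul_le_mul_right (c := N ^ q) ?_ (Nat.one_le_pow _ _ hN)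
    calc R.card * N * N ^ q = (R.card * N ^ q) * N := by ring
      _ ≤ (P.filter fun z => lev z = p).card * (E * N ^ k) * N := Nat.mul_le_mul_right _ h3
      _ = (P.filter fun z => lev z = p).card * N * (E * N ^ k) := by ring
      _ ≤ E * N ^ (k + p) * (E * N ^ k) := Nat.mul_le_mul_right _ (hA p)
      _ ≤ E * N ^ (k + q) * (E * N ^ k) := by gcongr
      _ = E ^ 2 * N ^ (2 * k) * N ^ q := by ring
  have hsum : Q.card = ∑ pq ∈ Finset.range (k + 1) ×ˢ Finset.range (k + 1),
      (Q.filter fun z => (lev z.1, lev z.2) = pq).card := by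
    refine Finset.card_eq_sum_card_fiberwise fun z hz => ?_
    obtain ⟨h1, h2, -⟩ := hQ z hz
    simpa using ⟨Nat.le_of_lt_succ (hlevk _ h1), Nat.le_of_lt_succ (hlevk _ h2)⟩
  have hpq : ∀ pq ∈ Finset.range (k + 1) ×ˢ Finset.range (k + 1),
      (Q.filter fun z => (lev z.1, lev z.2) = pq).card * N ≤ E ^ 2 * N ^ (2 * k) := by
    rintro ⟨p, q⟩ -
    rcases le_total p q with hpq | hpq
    · refine hpair p q hpq _ fun z hz => ?_
      obtain ⟨hz, hz'⟩ := Finset.mem_filter.1 hz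
      obtain ⟨h1, h2, h3⟩ := hQ z hz
      simp only [Prod.mk.injEq] at hz'
      exact ⟨h1, h2, h3, hz'⟩
    · rw [← Finset.card_image_of_injective _ Prod.swap_injective]
      refine hpair q p hpq _ fun z hz => ?_
      obtain ⟨w, hw, rfl⟩ := Finset.mem_image.1 hz
      obtain ⟨hz, hz'⟩ := Finset.mem_filter.1 hw
      obtain ⟨h1, h2, h3⟩ := hQ w hz
      simp only [Prod.mk.injEq] at hz'
      rw [abs_sub_comm] at h3
      exact ⟨h2, h1, h3, hz'.2, hz'.1⟩
  rw [hsum, Finset.sum_mul]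
  refine (Finset.sum_le_card_nsmul _ _ _ hpq).trans (le_of_eq ?_)
  rw [Finset.card_product, Finset.card_range, smul_eq_mul]
  ring

end CountingData

/-! ### Fourier decay and Poisson summation on `ℝ^ι`. -/

open scoped FourierTransform in
lemma exists_fourier_decay {V : Type*} [NormedAddCommGroup V] [InnerProductSpace ℝ V]
    [FiniteDimensional ℝ V] [MeasurableSpace V] [BorelSpace V] {g : V → ℂ}
    (hg : ContDiff ℝ ∞ g) (hs : HasCompactSupport g) (A : ℕ) :
    ∃ C : ℝ, 0 < C ∧ ∀ w, (1 + ‖w‖) ^ A * ‖𝓕 g w‖ ≤ C := by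
  let G := 𝓕 (hs.toSchwartzMap hg)
  refine ⟨max 1 (2 ^ A * (Finset.Iic (A, 0)).sup (fun m => SchwartzMap.seminorm ℝ m.1 m.2) G),
    by positivity, fun w => ?_⟩
  have := SchwartzMap.one_add_le_sup_seminorm_apply (𝕜 := ℝ) (m := (A, 0)) (k := A) (n := 0) le_rfl
    le_rfl G w
  rw [norm_iteratedFDeriv_zero] at this
  exact this.trans (le_max_right _ _)

/-- The additive character `x ↦ e^{2πix}`. -/
noncomputable def unitExp (x : ℝ) : ℂ := Complex.exp ((2 * Real.pi * x : ℝ) * Complex.I)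

lemma unitExp_add (x y : ℝ) : unitExp (x + y) = unitExp x * unitExp y := by
  simp only [unitExp, ← Complex.exp_add]
  congr 1
  push_cast
  ring

@[simp] lemma unitExp_zero : unitExp 0 = 1 := by simp [unitExp]

@[simp] lemma norm_unitExp (x : ℝ) : ‖unitExp x‖ = 1 := Complex.norm_exp_ofReal_mul_I _

lemma unitExp_intCast (n : ℤ) : unitExp n = 1 := by
  rw [unitExp, Complex.exp_eq_one_iff]
  exact ⟨n, by push_cast; ring⟩

lemma conj_unitExp (x : ℝ) : (starRingEnd ℂ) (unitExp x) = unitExp (-x) := by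
  rw [unitExp, unitExp, ← Complex.exp_conj, map_mul, Complex.conj_ofReal, Complex.conj_I]
  push_cast
  ring_nf

@[fun_prop] lemma continuous_unitExp : Continuous unitExp := by
  unfold unitExp
  fun_prop

lemma unitExp_sum {ι : Type*} (s : Finset ι) (g : ι → ℝ) :
    unitExp (∑ i ∈ s, g i) = ∏ i ∈ s, unitExp (g i) := by
  simp only [unitExp, ← Complex.exp_sum]
  congr 1
  push_cast
  rw [Finset.mul_sum, Finset.sum_mul]

lemma periodization_add_int {ι : Type*} (f : (ι → ℝ) → ℂ) (t : ι → ℝ) (n : ι → ℤ) :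
    ∑' m : ι → ℤ, f (fun i => t i + n i - m i) = ∑' m : ι → ℤ, f (fun i => t i - m i) := by
  rw [← (Equiv.addRight n).tsum_eq]
  refine tsum_congr fun m => congrArg f (funext fun i => ?_)
  simp only [Equiv.coe_addRight, Pi.add_apply, Int.cast_add]
  ring

/-- The `ℤ^ι`-periodization of `f` as a function on the torus. -/
noncomputable def torusPeriodization {ι : Type*} (f : (ι → ℝ) → ℂ) (x : UnitAddTorus ι) : ℂ :=
  ∑' m : ι → ℤ, f (fun i => (AddCircle.equivIoc 1 0 (x i) : ℝ) - m i)

lemma torusPeriodization_coe {ι : Type*} (f : (ι → ℝ) → ℂ) (t : ι → ℝ) :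
    torusPeriodization f (fun i => (t i : UnitAddCircle)) = ∑' m : ι → ℤ, f (fun i => t i - m i) := by
  have h1 : ∀ i, ∃ n : ℤ, (AddCircle.equivIoc 1 0 (t i : UnitAddCircle) : ℝ) = t i + n := by
    intro i
    have h2 : ((AddCircle.equivIoc 1 0 (t i : UnitAddCircle) : ℝ) : UnitAddCircle) = t i :=
      (AddCircle.equivIoc 1 0).symm_apply_apply _
    rw [← sub_eq_zero, ← AddCircle.coe_sub, AddCircle.coe_eq_zero_iff] at h2
    obtain ⟨n, hn⟩ := h2
    exact ⟨n, by rw [zsmul_one] at hn; linarith⟩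
  choose n hn using h1
  rw [torusPeriodization, ← periodization_add_int f t n]
  simp only [hn]

/-- The Fourier integral on `ℝ^ι` in coordinates. -/
noncomputable def coordFourier {ι : Type*} [Fintype ι] (f : (ι → ℝ) → ℂ) (ξ : ι → ℝ) : ℂ :=
  ∫ t, unitExp (-∑ i, ξ i * t i) * f t

section

variable {ι : Type*} [Fintype ι]

lemma exists_coordFourier_decay {f : (ι → ℝ) → ℂ} (hf : ContDiff ℝ ∞ f) (hs : HasCompactSupport f)
    (A : ℕ) : ∃ C : ℝ, 0 < C ∧ ∀ ξ, (1 + ‖ξ‖) ^ A * ‖coordFourier f ξ‖ ≤ C := by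
  let e := EuclideanSpace.equiv ι ℝ
  obtain ⟨C, hC0, hC⟩ := exists_fourier_decay (g := f ∘ e) (hf.comp e.contDiff)
    (hs.comp_homeomorph e.toHomeomorph) A
  refine ⟨C, hC0, fun ξ => ?_⟩
  have h1 : FourierTransform.fourier (f ∘ e) (e.symm ξ) = coordFourier f ξ := by
    rw [Real.fourier_eq', coordFourier,
      ← (EuclideanSpace.volume_preserving_symm_measurableEquiv_toLp ι).integral_comp'
        (fun t => unitExp (-∑ i, ξ i * t i) * f t)]
    refine integral_congr_ae (.of_forall fun v => ?_)
    have h2 : inner ℝ v (e.symm ξ) = ∑ i, ξ i * v i := by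
      simp [PiLp.inner_apply, e]
    beta_reduce
    rw [h2, smul_eq_mul, unitExp, show -2 * Real.pi * ∑ i, ξ i * v i =
      2 * Real.pi * -∑ i, ξ i * v i by ring]
    rfl
  rw [← h1]
  refine le_trans ?_ (hC (e.symm ξ))
  gcongr
  rw [pi_norm_le_iff_of_nonneg (norm_nonneg _)]
  intro i
  exact PiLp.norm_apply_le (e.symm ξ) i

/-- The integer points of a cube. -/
noncomputable def intCube (ι : Type*) [Fintype ι] [DecidableEq ι] (B : ℕ) : Finset (ι → ℤ) :=
  Fintype.piFinset fun _ => Finset.Icc (-(B : ℤ)) B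

lemma mem_intCube [DecidableEq ι] {B : ℕ} {m : ι → ℤ} : m ∈ intCube ι B ↔ ∀ i, |m i| ≤ (B : ℤ) := by
  simp [intCube, Fintype.mem_piFinset, abs_le]

lemma exists_support_bound {f : (ι → ℝ) → ℂ} (hs : HasCompactSupport f) :
    ∃ R : ℕ, ∀ t, f t ≠ 0 → ∀ i, |t i| ≤ R := by
  obtain ⟨r, hr⟩ := hs.isCompact.isBounded.exists_norm_le
  refine ⟨⌈r⌉₊, fun t ht i => ?_⟩
  have h1 := hr t (subset_tsupport f ht)
  exact ((norm_le_pi_norm t i).trans h1).trans (Nat.le_ceil r)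

lemma apply_sub_eq_zero [DecidableEq ι] {f : (ι → ℝ) → ℂ} {R : ℕ}
    (hR : ∀ t, f t ≠ 0 → ∀ i, |t i| ≤ R) {K : ℕ} {t : ι → ℝ} (ht : ∀ i, |t i| ≤ K) {m : ι → ℤ}
    (hm : m ∉ intCube ι (R + K)) : f (fun i => t i - m i) = 0 := by
  by_contra h0
  apply hm
  rw [mem_intCube]
  intro i
  have h1 := hR _ h0 i
  have h2 := ht i
  have h3 : |(m i : ℝ)| ≤ R + K := by
    have := abs_sub_abs_le_abs_sub (m i : ℝ) (t i)
    rw [abs_sub_comm] at this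
    linarith
  exact_mod_cast h3

lemma hasSum_periodization [DecidableEq ι] {f : (ι → ℝ) → ℂ} {R : ℕ}
    (hR : ∀ t, f t ≠ 0 → ∀ i, |t i| ≤ R) {K : ℕ} {t : ι → ℝ} (ht : ∀ i, |t i| ≤ K) :
    HasSum (fun m : ι → ℤ => f (fun i => t i - m i))
      (∑ m ∈ intCube ι (R + K), f (fun i => t i - m i)) :=
  hasSum_sum_of_ne_finset_zero fun _ hm => apply_sub_eq_zero hR ht hm

lemma continuous_periodization {f : (ι → ℝ) → ℂ} (hf : Continuous f) (hs : HasCompactSupport f) :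
    Continuous fun t : ι → ℝ => ∑' m : ι → ℤ, f (fun i => t i - m i) := by
  classical
  obtain ⟨R, hR⟩ := exists_support_bound hs
  rw [continuous_iff_continuousAt]
  intro t₀
  have h1 : (fun t : ι → ℝ => ∑' m : ι → ℤ, f (fun i => t i - m i)) =ᶠ[nhds t₀]
      fun t => ∑ m ∈ intCube ι (R + ⌈‖t₀‖ + 1⌉₊), f (fun i => t i - m i) := by
    filter_upwards [Metric.ball_mem_nhds t₀ one_pos] with t ht
    refine (hasSum_periodization hR fun i => ?_).tsum_eq
    have h2 : ‖t‖ ≤ ‖t₀‖ + 1 := by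
      have := norm_sub_norm_le t t₀
      rw [Metric.mem_ball, dist_eq_norm] at ht
      linarith
    exact ((norm_le_pi_norm t i).trans h2).trans (Nat.le_ceil _)
  refine ContinuousAt.congr ?_ h1.symm
  refine Continuous.continuousAt ?_
  fun_prop


/-- Continuity descends along the open quotient map from `ℝ^ι`, which avoids the discontinuous
representative in the definition. -/
lemma continuous_torusPeriodization {f : (ι → ℝ) → ℂ} (hf : Continuous f)
    (hs : HasCompactSupport f) : Continuous (torusPeriodization f) := by
  have hq : IsOpenQuotientMap fun (t : ι → ℝ) (i : ι) => (t i : UnitAddCircle) :=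
    IsOpenQuotientMap.piMap fun _ => QuotientAddGroup.isOpenQuotientMap_mk
  rw [← hq.continuous_comp_iff]
  refine (continuous_periodization hf hs).congr fun t => ?_
  rw [Function.comp_apply, torusPeriodization_coe]

lemma mFourier_coe (n : ι → ℤ) (t : ι → ℝ) :
    UnitAddTorus.mFourier n (fun i => (t i : UnitAddCircle)) = unitExp (∑ i, n i * t i) := by
  rw [unitExp_sum]
  simp only [UnitAddTorus.mFourier, ContinuousMap.coe_mk]
  refine Finset.prod_congr rfl fun i _ => ?_
  rw [fourier_coe_apply, unitExp]
  congr 1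
  push_cast
  ring

/-- Unfolding: the integral over the unit box of a sum of translates is the integral over the union
of the translated boxes, which covers the support of `f`. -/
lemma mFourierCoeff_torusPeriodization {f : (ι → ℝ) → ℂ} (hf : Continuous f)
    (hs : HasCompactSupport f) (n : ι → ℤ) :
    UnitAddTorus.mFourierCoeff (torusPeriodization f) n = coordFourier f fun i => n i := by
  classical
  obtain ⟨R, hR⟩ := exists_support_bound hs
  let g : (ι → ℝ) → ℂ := fun t => unitExp (-∑ i, n i * t i) * f t
  have hg : Continuous g := by fun_prop
  have hgs : HasCompactSupport g := hs.mul_left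
  have hgi : Integrable g := hg.integrable_of_hasCompactSupport hgs
  let box : (ι → ℤ) → Set (ι → ℝ) := fun m => {x | ∀ i, x i + m i ∈ Set.Ioc (0 : ℝ) 1}
  have hbox : ∀ m, MeasurableSet (box m) := fun m => by
    have : box m = ⋂ i, {x : ι → ℝ | x i + (m i : ℝ) ∈ Set.Ioc (0 : ℝ) 1} := by ext; simp [box]
    rw [this]
    exact MeasurableSet.iInter fun i => measurableSet_Ioc.preimage
      (Measurable.add_const (f := fun x : ι → ℝ => x i) (measurable_pi_apply i) _)
  have hbox0 : {x : ι → ℝ | ∀ i, x i ∈ Set.Ioc (0 : ℝ) (0 + 1)} = box 0 := by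
    ext; simp [box]
  rw [UnitAddTorus.mFourierCoeff_eq_integral _ _ (fun _ => 0), hbox0]
  have h1 : ∀ x ∈ box 0, UnitAddTorus.mFourier (-n) (fun i => (x i : UnitAddCircle)) •
      torusPeriodization f (fun i => (x i : UnitAddCircle)) =
      ∑ m ∈ intCube ι (R + 1), g (fun i => x i - m i) := by
    intro x hx
    rw [mFourier_coe, torusPeriodization_coe,
      (hasSum_periodization hR (K := 1) (t := x) fun i => ?_).tsum_eq, smul_eq_mul, Finset.mul_sum]
    · refine Finset.sum_congr rfl fun m _ => ?_
      simp only [g]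
      congr 1
      have h2 : -∑ i, (n i : ℝ) * (x i - m i) = ∑ i, ((-n) i : ℤ) * x i +
          ((∑ i, n i * m i : ℤ) : ℝ) := by
        push_cast
        rw [← Finset.sum_neg_distrib, ← Finset.sum_add_distrib]
        refine Finset.sum_congr rfl fun i _ => ?_
        simp only [Pi.neg_apply, Int.cast_neg]
        ring
      rw [h2, unitExp_add, unitExp_intCast, mul_one]
    · have := hx i
      simp only [Pi.zero_apply, Int.cast_zero, add_zero, Set.mem_Ioc] at this
      rw [abs_le]
      push_cast
      constructor <;> linarith
  rw [setIntegral_congr_fun (hbox 0) h1, integral_finsetSum]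
  · have h3 : ∀ m ∈ intCube ι (R + 1), ∫ x in box 0, g (fun i => x i - m i) = ∫ x in box m, g x := by
      intro m _
      rw [← integral_indicator (hbox 0), ← integral_indicator (hbox m),
        ← integral_add_right_eq_self _ (fun i => (m i : ℝ))]
      refine integral_congr_ae (.of_forall fun x => ?_)
      simp only [Set.indicator_apply, box, Set.mem_ofPred_eq, Pi.add_apply, Pi.zero_apply,
        Int.cast_zero, add_zero, add_sub_cancel_right]
    rw [Finset.sum_congr rfl h3, ← integral_biUnion_finset]
    · rw [coordFourier]
      refine setIntegral_eq_integral_of_forall_compl_eq_zero fun x hx => ?_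
      by_contra h0
      apply hx
      have hfx : f x ≠ 0 := right_ne_zero_of_mul h0
      simp only [Set.mem_iUnion]
      -- The unique integer shift moving `x i` into `(0, 1]`.
      refine ⟨fun i => 1 - ⌈x i⌉, ?_, fun i => ?_⟩
      · rw [mem_intCube]
        intro i
        have h4 := abs_le.1 (hR x hfx i)
        have h5 : ⌈x i⌉ ≤ R := Int.ceil_le.2 (by exact_mod_cast h4.2)
        have h6 : -(R : ℤ) ≤ ⌈x i⌉ := by
          have := (h4.1.trans (Int.le_ceil (x i)))
          exact_mod_cast this
        rw [abs_le]
        push_cast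
        constructor <;> linarith
      · have := Int.le_ceil (x i)
        have := Int.ceil_lt_add_one (x i)
        push_cast
        constructor <;> linarith
    · exact fun m _ => hbox m
    · intro m _ m' _ hmm
      refine Set.disjoint_left.2 fun x hx hx' => hmm (funext fun i => ?_)
      have h4 := hx i
      have h5 := hx' i
      have h6 : ((m i : ℝ)) < m' i + 1 := by linarith [h4.2, h5.1]
      have h7 : ((m' i : ℝ)) < m i + 1 := by linarith [h4.1, h5.2]
      have h6' : m i < m' i + 1 := by exact_mod_cast h6
      have h7' : m' i < m i + 1 := by exact_mod_cast h7
      omega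
    · exact fun m _ => hgi.integrableOn
  · intro m _
    exact (hgi.comp_sub_right (fun i => (m i : ℝ))).integrableOn

/-- Poisson summation: the Fourier expansion of the periodization. -/
theorem hasSum_coordFourier {f : (ι → ℝ) → ℂ} (hf : Continuous f) (hs : HasCompactSupport f)
    (hsum : Summable fun n : ι → ℤ => coordFourier f fun i => n i) (t : ι → ℝ) :
    HasSum (fun n : ι → ℤ => coordFourier f (fun i => n i) * unitExp (∑ i, n i * t i))
      (∑' m : ι → ℤ, f fun i => t i - m i) := by
  let F : C(UnitAddTorus ι, ℂ) := ⟨torusPeriodization f, continuous_torusPeriodization hf hs⟩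
  have hF : UnitAddTorus.mFourierCoeff F = fun n : ι → ℤ => coordFourier f fun i => n i :=
    funext fun n => mFourierCoeff_torusPeriodization hf hs n
  have h1 : Summable (UnitAddTorus.mFourierCoeff F) := by rwa [hF]
  have h2 := UnitAddTorus.hasSum_mFourier_series_apply_of_summable h1
    (fun i => (t i : UnitAddCircle))
  rw [hF] at h2
  simp only [mFourier_coe, smul_eq_mul] at h2
  rw [← torusPeriodization_coe]
  exact h2

lemma coordFourier_comp_mul (f : (ι → ℝ) → ℂ) {N : ℝ} (hN : 0 < N) (ξ : ι → ℝ) :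
    coordFourier (fun t => f fun i => N * t i) ξ =
      ((N ^ Fintype.card ι)⁻¹ : ℝ) * coordFourier f fun i => ξ i / N := by
  have h1 := Measure.integral_comp_smul (volume : Measure (ι → ℝ))
    (fun t => unitExp (-∑ i, ξ i / N * t i) * f t) N
  rw [Module.finrank_fintype_fun_eq_card, abs_of_pos (by positivity), Complex.real_smul] at h1
  rw [coordFourier, coordFourier, ← h1]
  refine integral_congr_ae (.of_forall fun t => ?_)
  have h2 : ∀ i, ξ i / N * (N • t) i = ξ i * t i := fun i => by
    simp only [Pi.smul_apply, smul_eq_mul]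
    field_simp
  simp only [h2]
  rfl

end

lemma summable_pi_prod {ι : Type*} [Fintype ι] {g : ℤ → ℝ} (h0 : ∀ j, 0 ≤ g j) (hg : Summable g) :
    Summable fun n : ι → ℤ => ∏ i, g (n i) := by
  classical
  refine summable_of_sum_le (c := ∏ _i : ι, ∑' j, g j)
    (fun n => Finset.prod_nonneg fun i _ => h0 _) fun s => ?_
  have hsub : s ⊆ Fintype.piFinset fun i => s.image fun n => n i := fun n hn =>
    Fintype.mem_piFinset.2 fun i => Finset.mem_image_of_mem (fun n => n i) hn
  refine (Finset.sum_le_sum_of_subset_of_nonneg hsub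
    fun n _ _ => Finset.prod_nonneg fun i _ => h0 _).trans ?_
  rw [← Finset.prod_univ_sum (fun i => s.image fun n => n i) fun _ j => g j]
  exact Finset.prod_le_prod (fun i _ => Finset.sum_nonneg fun j _ => h0 j)
    fun i _ => hg.sum_le_tsum _ fun j _ => h0 j

lemma summable_int_inv_sq : Summable fun j : ℤ => ((1 + |(j : ℝ)|) ^ 2)⁻¹ := by
  have h1 : Summable fun n : ℕ => ((1 + (n : ℝ)) ^ 2)⁻¹ := by
    have := (summable_nat_add_iff 1).2 (Real.summable_nat_pow_inv.2 (one_lt_two))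
    refine this.congr fun n => ?_
    push_cast
    rw [add_comm]
  refine Summable.of_nat_of_neg ?_ ?_
  · simpa using h1
  · simpa using h1

/-- A summable weight on `ℤ^ι`. -/
noncomputable def intWeight {ι : Type*} [Fintype ι] (n : ι → ℤ) : ℝ :=
  ∏ i, ((1 + |(n i : ℝ)|) ^ 2)⁻¹

section

variable {ι : Type*} [Fintype ι]

lemma intWeight_nonneg (n : ι → ℤ) : 0 ≤ intWeight n :=
  Finset.prod_nonneg fun _ _ => by positivity

lemma summable_intWeight : Summable fun n : ι → ℤ => intWeight n :=
  summable_pi_prod (g := fun j => ((1 + |(j : ℝ)|) ^ 2)⁻¹) (fun _ => by positivity) summable_int_inv_sq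

/-- Coordinatewise, `1 + |n i| ≤ N (1 + |n i| / N)`. -/
lemma one_le_mul_intWeight {N : ℝ} (hN : 1 ≤ N) (n : ι → ℤ) :
    1 ≤ (1 + ‖fun i => (n i : ℝ) / N‖) ^ (2 * Fintype.card ι) *
      (N ^ (2 * Fintype.card ι) * intWeight n) := by
  have h0 : 0 < N := by linarith
  have h1 : (1 : ℝ) = ∏ _i : ι, 1 := by simp
  have h3 : ∀ i, |(n i : ℝ)| / N ≤ ‖fun i => (n i : ℝ) / N‖ := fun i => by
    have := norm_le_pi_norm (fun i => (n i : ℝ) / N) i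
    rwa [Real.norm_eq_abs, abs_div, abs_of_pos h0] at this
  generalize ‖fun i => (n i : ℝ) / N‖ = Y at h3 ⊢
  have h2 : (1 + Y) ^ (2 * Fintype.card ι) * (N ^ (2 * Fintype.card ι) * intWeight n) =
      ∏ i, ((1 + Y) ^ 2 * N ^ 2 * ((1 + |(n i : ℝ)|) ^ 2)⁻¹) := by
    rw [Finset.prod_mul_distrib, Finset.prod_const, intWeight, Finset.card_univ, mul_pow,
      ← pow_mul, ← pow_mul, mul_assoc]
  rw [h2]
  conv_lhs => rw [h1]
  refine Finset.prod_le_prod (fun _ _ => zero_le_one) fun i _ => ?_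
  have h4 : |(n i : ℝ)| / N ≤ Y := h3 i
  rw [← mul_pow, ← div_eq_mul_inv, le_div_iff₀ (by positivity), one_mul]
  gcongr
  rw [div_le_iff₀ h0] at h4
  nlinarith

/-- Two further powers of decay per coordinate are traded for a summable weight, at the price of a
power of `N`; the exponent `A` stays available for truncation. -/
lemma exists_coordFourier_le {f : (ι → ℝ) → ℂ} (hf : ContDiff ℝ ∞ f) (hs : HasCompactSupport f)
    (A : ℕ) : ∃ C : ℝ, 0 < C ∧ ∀ N : ℝ, 1 ≤ N → ∀ n : ι → ℤ,
      (1 + ‖fun i => (n i : ℝ) / N‖) ^ A * ‖coordFourier f fun i => (n i : ℝ) / N‖ ≤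
        C * (N ^ (2 * Fintype.card ι) * intWeight n) := by
  obtain ⟨C, hC0, hC⟩ := exists_coordFourier_decay hf hs (A + 2 * Fintype.card ι)
  refine ⟨C, hC0, fun N hN n => ?_⟩
  set X := 1 + ‖fun i => (n i : ℝ) / N‖
  set w := N ^ (2 * Fintype.card ι) * intWeight n
  have hw : 0 ≤ w := mul_nonneg (by positivity) (intWeight_nonneg n)
  have h1 := one_le_mul_intWeight hN n
  have h2 := hC fun i => (n i : ℝ) / N
  calc X ^ A * ‖coordFourier f fun i => (n i : ℝ) / N‖
      ≤ X ^ A * ‖coordFourier f fun i => (n i : ℝ) / N‖ * (X ^ (2 * Fintype.card ι) * w) :=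
        le_mul_of_one_le_right (by positivity) h1
    _ = X ^ (A + 2 * Fintype.card ι) * ‖coordFourier f fun i => (n i : ℝ) / N‖ * w := by
        rw [pow_add]; ring
    _ ≤ C * w := mul_le_mul_of_nonneg_right h2 hw

end

/-! ### Fourier expansion of the correlation sum, its main term and its truncation. -/

lemma mem_distinctTuples {k N : ℕ} {x : Fin k → ℕ} :
    x ∈ distinctTuples k N ↔ (∀ i, 1 ≤ x i ∧ x i ≤ N) ∧ Function.Injective x := by
  classical
  simp only [distinctTuples, Finset.mem_filter, Fintype.mem_piFinset, Finset.mem_Icc]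

lemma card_distinctTuples (k N : ℕ) : (distinctTuples k N).card = N.descFactorial k := by
  classical
  have h1 : Fintype.card (Fin k ↪ Finset.Icc 1 N) = N.descFactorial k := by
    rw [Fintype.card_embedding_eq]
    simp
  rw [← h1, ← Finset.card_univ]
  symm
  refine Finset.card_nbij (fun e i => (e i : ℕ)) ?_ ?_ ?_
  · intro e _
    exact mem_distinctTuples.2 ⟨fun i => Finset.mem_Icc.1 (e i).2, fun i j hij => e.injective (Subtype.ext hij)⟩
  · intro e _ e' _ h
    ext i
    exact congrFun h i
  · intro x hx
    replace hx := mem_distinctTuples.1 hx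
    exact ⟨⟨fun i => ⟨x i, Finset.mem_Icc.2 (hx.1 i)⟩, fun i j hij => hx.2 (congrArg Subtype.val hij)⟩, by simp, rfl⟩

lemma diagFactor_eq {k N : ℕ} (hN : 1 ≤ N) (hk : 1 ≤ k) :
    diagFactor k N = ((N : ℝ) ^ k)⁻¹ * (distinctTuples k N).card := by
  have hN0 : (N : ℝ) ≠ 0 := by positivity
  rw [card_distinctTuples, ← descPochhammer_eval_eq_descFactorial, descPochhammer_eval_eq_prod_range]
  have h1 : ∏ j ∈ Finset.range k, ((N : ℝ) - j) = N ^ k * ∏ j ∈ Finset.range k, (1 - (j : ℝ) / N) := by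
    conv_rhs => rw [← Finset.card_range k, ← Finset.prod_const, Finset.card_range,
      ← Finset.prod_mul_distrib]
    refine Finset.prod_congr rfl fun j _ => ?_
    field_simp
  rw [h1, inv_mul_cancel_left₀ (pow_ne_zero k hN0), Finset.range_eq_Ico,
    Finset.prod_eq_prod_Ico_succ_bot hk]
  simp [diagFactor]

/-- The Fourier coefficient of the correlation sum at `n`, including the exponential sum. -/
noncomputable def correlationTerm (k : ℕ) (f : (Fin (k - 1) → ℝ) → ℝ) (b : ℕ → ℝ) (N : ℕ)
    (n : Fin (k - 1) → ℤ) : ℂ :=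
  ((N : ℂ) ^ k)⁻¹ * (coordFourier (fun t => (f t : ℂ)) (fun i => (n i : ℝ) / N) *
    ∑ x ∈ distinctTuples k N, unitExp (∑ i, n i * consecutiveDiff b x i))

section

variable {k : ℕ} {f : (Fin (k - 1) → ℝ) → ℝ}

lemma contDiff_ofReal_comp (hf : ContDiff ℝ ∞ f) : ContDiff ℝ ∞ fun t => (f t : ℂ) :=
  Complex.ofRealCLM.contDiff.comp hf

lemma hasCompactSupport_ofReal_comp (hs : HasCompactSupport f) :
    HasCompactSupport fun t => (f t : ℂ) :=
  hs.comp_left (g := fun x : ℝ => (x : ℂ)) Complex.ofReal_zero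

lemma hasSum_coordFourier_scaled {ι : Type*} [Fintype ι] {F : (ι → ℝ) → ℂ} (hF : ContDiff ℝ ∞ F)
    (hs : HasCompactSupport F) {N : ℝ} (hN : 1 ≤ N) (t : ι → ℝ) :
    Summable (fun m : ι → ℤ => F fun i => N * (t i - m i)) ∧
    HasSum (fun n : ι → ℤ => ((N ^ Fintype.card ι)⁻¹ : ℝ) *
      coordFourier F (fun i => (n i : ℝ) / N) * unitExp (∑ i, n i * t i))
      (∑' m : ι → ℤ, F fun i => N * (t i - m i)) := by
  classical
  have hN0 : 0 < N := by linarith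
  let G : (ι → ℝ) → ℂ := fun t => F (N • t)
  have hc : Continuous G := hF.continuous.comp (continuous_const_smul N)
  have hcs : HasCompactSupport G := hs.comp_smul hN0.ne'
  have hcoef : ∀ n : ι → ℤ, coordFourier G (fun i => n i) =
      ((N ^ Fintype.card ι)⁻¹ : ℝ) * coordFourier F fun i => (n i : ℝ) / N := fun n =>
    coordFourier_comp_mul F hN0 fun i => n i
  have hG : ∀ m : ι → ℤ, (F fun i => N * (t i - m i)) = G fun i => t i - m i := fun m => rfl
  have hsum : Summable fun n : ι → ℤ => coordFourier G fun i => n i := by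
    obtain ⟨C, -, hC⟩ := exists_coordFourier_le hF hs 0
    simp only [hcoef]
    refine Summable.mul_left _ (Summable.of_norm_bounded
      ((summable_intWeight.mul_left (N ^ (2 * Fintype.card ι))).mul_left C) fun n => ?_)
    have := hC N hN n
    rwa [pow_zero, one_mul] at this
  simp only [hG, ← hcoef]
  refine ⟨?_, hasSum_coordFourier hc hcs hsum t⟩
  obtain ⟨R, hR⟩ := exists_support_bound hcs
  exact (hasSum_periodization hR (K := ⌈‖t‖⌉₊) fun i =>
    (norm_le_pi_norm t i).trans (Nat.le_ceil _)).summable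

lemma hasSum_correlationTerm (hf : ContDiff ℝ ∞ f) (hs : HasCompactSupport f) (hk : 1 ≤ k)
    (b : ℕ → ℝ) {N : ℕ} (hN : 1 ≤ N) :
    HasSum (correlationTerm k f b N) (correlationSum k f b N : ℂ) := by
  have hN1 : (1 : ℝ) ≤ N := by exact_mod_cast hN
  have hx := fun t => hasSum_coordFourier_scaled (contDiff_ofReal_comp hf)
    (hasCompactSupport_ofReal_comp hs) hN1 t
  have h1 := (hasSum_sum fun x (_ : x ∈ distinctTuples k N) =>
    (hx (consecutiveDiff b x)).2).mul_left ((N : ℂ)⁻¹)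
  have h2 : (correlationSum k f b N : ℂ) = (N : ℂ)⁻¹ * ∑ x ∈ distinctTuples k N,
      ∑' m : Fin (k - 1) → ℤ, (f (fun i => (N : ℝ) * (consecutiveDiff b x i - m i)) : ℂ) := by
    rw [← Summable.tsum_finsetSum fun x _ => (hx (consecutiveDiff b x)).1, correlationSum]
    push_cast [Complex.ofReal_tsum]
    rw [one_div]
  rw [h2]
  refine h1.congr_fun fun n => ?_
  have h3 : (N : ℂ) ^ k = N * N ^ (k - 1) := by rw [← pow_succ', Nat.sub_add_cancel hk]
  rw [correlationTerm, ← Finset.mul_sum, h3, mul_inv, Fintype.card_fin]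
  push_cast
  ring

lemma correlationTerm_zero (hk : 1 ≤ k) (b : ℕ → ℝ) {N : ℕ} (hN : 1 ≤ N) :
    correlationTerm k f b N 0 = ((diagFactor k N * ∫ t, f t : ℝ) : ℂ) := by
  rw [correlationTerm, diagFactor_eq hN hk, coordFourier]
  simp only [Pi.zero_apply, Int.cast_zero, zero_div, zero_mul, Finset.sum_const_zero, neg_zero,
    unitExp_zero, one_mul, Finset.sum_const, nsmul_eq_mul, mul_one]
  rw [integral_complex_ofReal]
  push_cast
  ring

lemma norm_correlationTerm_le (b : ℕ → ℝ) {N : ℕ} (hN : 1 ≤ N) (n : Fin (k - 1) → ℤ) :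
    ‖correlationTerm k f b N n‖ ≤
      ‖coordFourier (fun t => (f t : ℂ)) (fun i => (n i : ℝ) / N)‖ := by
  have hN0 : (0 : ℝ) < N := by exact_mod_cast hN
  rw [correlationTerm, norm_mul, norm_mul, norm_inv, norm_pow, Complex.norm_natCast]
  have h1 : ‖∑ x ∈ distinctTuples k N, unitExp (∑ i, n i * consecutiveDiff b x i)‖ ≤ (N : ℝ) ^ k := by
    refine (norm_sum_le _ _).trans ?_
    simp only [norm_unitExp, Finset.sum_const, nsmul_eq_mul, mul_one]
    rw [card_distinctTuples]
    exact_mod_cast Nat.descFactorial_le_pow N k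
  calc _ ≤ ((N : ℝ) ^ k)⁻¹ * (‖coordFourier (fun t => (f t : ℂ)) (fun i => (n i : ℝ) / N)‖ *
        (N : ℝ) ^ k) := by gcongr
    _ = _ := by field_simp

lemma continuous_correlationSum (hf : ContDiff ℝ ∞ f) (hs : HasCompactSupport f) (hk : 1 ≤ k)
    (a : ℕ → ℝ) {N : ℕ} (hN : 1 ≤ N) :
    Continuous fun α : ℝ => correlationSum k f (fun n => α * a n) N := by
  have hN1 : (1 : ℝ) ≤ N := by exact_mod_cast hN
  obtain ⟨C, -, hC⟩ := exists_coordFourier_le (contDiff_ofReal_comp hf)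
    (hasCompactSupport_ofReal_comp hs) 0
  have h1 : Continuous fun α : ℝ => ∑' n, correlationTerm k f (fun n => α * a n) N n := by
    refine continuous_tsum (fun n => ?_)
      ((summable_intWeight.mul_left ((N : ℝ) ^ (2 * Fintype.card (Fin (k - 1))))).mul_left C)
      fun n α => (norm_correlationTerm_le _ hN n).trans ?_
    · unfold correlationTerm consecutiveDiff
      fun_prop
    · simpa using hC N hN1 n
  have h2 : (fun α : ℝ => correlationSum k f (fun n => α * a n) N) =
      fun α => (∑' n, correlationTerm k f (fun n => α * a n) N n).re := by
    funext α
    rw [(hasSum_correlationTerm hf hs hk _ hN).tsum_eq, Complex.ofReal_re]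
  rw [h2]
  exact Complex.continuous_re.comp h1

lemma integrable_varianceIntegrand (hf : ContDiff ℝ ∞ f) (hs : HasCompactSupport f) (hk : 1 ≤ k)
    {ρ : ℝ → ℝ} (hρ : Continuous ρ) (hρs : HasCompactSupport ρ) (a : ℕ → ℝ) {N : ℕ} (hN : 1 ≤ N) :
    Integrable (varianceIntegrand k f ρ a N) := by
  have h1 := continuous_correlationSum hf hs hk a hN
  refine Continuous.integrable_of_hasCompactSupport ?_ hρs.mul_left
  unfold varianceIntegrand
  fun_prop

/-- Truncation of the Fourier expansion of the correlation sum. -/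
lemma exists_norm_sub_sum_le (hf : ContDiff ℝ ∞ f) (hs : HasCompactSupport f) (hk : 1 ≤ k) (A : ℕ) :
    ∃ C : ℝ, 0 < C ∧ ∀ (b : ℕ → ℝ) (N B : ℕ), 1 ≤ N →
      (1 + ((B : ℝ) + 1) / N) ^ A *
      ‖((correlationSum k f b N - diagFactor k N * ∫ t, f t : ℝ) : ℂ) -
        ∑ n ∈ (intCube (Fin (k - 1)) B).erase 0, correlationTerm k f b N n‖ ≤
      C * (N : ℝ) ^ (2 * (k - 1)) := by
  obtain ⟨C, hC0, hC⟩ := exists_coordFourier_le (contDiff_ofReal_comp hf)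
    (hasCompactSupport_ofReal_comp hs) A
  set S := ∑' n : Fin (k - 1) → ℤ, intWeight n with hS
  have hS0 : 0 ≤ S := tsum_nonneg intWeight_nonneg
  refine ⟨C * (S + 1), by positivity, fun b N B hN => ?_⟩
  have hN1 : (1 : ℝ) ≤ N := by exact_mod_cast hN
  have hN0 : (0 : ℝ) < N := by linarith
  set X : ℝ := (1 + ((B : ℝ) + 1) / N) ^ A with hX
  have hX0 : 0 < X := by positivity
  have h0 : (0 : Fin (k - 1) → ℤ) ∈ intCube (Fin (k - 1)) B := mem_intCube.2 fun i => by simp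
  have h1 := hasSum_correlationTerm hf hs hk b hN
  have h2 : HasSum (fun n => if n ∈ intCube (Fin (k - 1)) B then correlationTerm k f b N n else 0)
      (∑ n ∈ intCube (Fin (k - 1)) B, correlationTerm k f b N n) := by
    have := hasSum_sum_of_ne_finset_zero (L := .unconditional _) (s := intCube (Fin (k - 1)) B)
      (f := fun n => if n ∈ intCube (Fin (k - 1)) B then correlationTerm k f b N n else 0)
      (fun n hn => if_neg hn)
    rwa [Finset.sum_congr rfl fun n hn => if_pos hn] at this
  have h3 := h1.sub h2
  rw [← Finset.add_sum_erase _ _ h0, correlationTerm_zero hk b hN, ← sub_sub,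
    ← Complex.ofReal_sub] at h3
  have h4 := h3.norm_le_of_bounded
    ((summable_intWeight.hasSum.mul_left ((N : ℝ) ^ (2 * (k - 1)))).mul_left (X⁻¹ * C))
    fun n => ?_
  · calc _ ≤ X * (X⁻¹ * C * ((N : ℝ) ^ (2 * (k - 1)) * S)) := mul_le_mul_of_nonneg_left h4 hX0.le
      _ = C * S * (N : ℝ) ^ (2 * (k - 1)) := by field_simp
      _ ≤ C * (S + 1) * (N : ℝ) ^ (2 * (k - 1)) := by gcongr; linarith
  · have hw := intWeight_nonneg n
    split_ifs with hn
    · rw [sub_self, norm_zero]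
      positivity
    · rw [sub_zero]
      refine (norm_correlationTerm_le b hN n).trans ?_
      have h5 := hC N hN1 n
      rw [Fintype.card_fin] at h5
      have h6 : X ≤ (1 + ‖fun i => (n i : ℝ) / N‖) ^ A := by
        rw [mem_intCube] at hn
        push Not at hn
        obtain ⟨i, hi⟩ := hn
        have h7 := norm_le_pi_norm (fun i => (n i : ℝ) / N) i
        rw [Real.norm_eq_abs, abs_div, abs_of_pos hN0] at h7
        have h8 : (B : ℝ) + 1 ≤ |(n i : ℝ)| := by
          have : (B : ℤ) + 1 ≤ |n i| := hi
          exact_mod_cast this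
        have h9 : ((B : ℝ) + 1) / N ≤ |(n i : ℝ)| / N := by gcongr
        exact pow_le_pow_left₀ (by positivity) (by linarith) A
      rw [mul_assoc, ← div_eq_inv_mul, le_div_iff₀' hX0]
      exact (mul_le_mul_of_nonneg_right h6 (norm_nonneg _)).trans h5

end

/-! ### The weighted mean square of an exponential sum. -/

lemma exists_integral_unitExp_decay {ρ : ℝ → ℝ} (hρ : ContDiff ℝ ∞ ρ) (hs : HasCompactSupport ρ)
    (B : ℕ) : ∃ C : ℝ, 0 < C ∧ ∀ s : ℝ, |s| ^ B * ‖∫ α, unitExp (s * α) * ρ α‖ ≤ C := by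
  have h1 : ContDiff ℝ ∞ fun t => (ρ t : ℂ) := Complex.ofRealCLM.contDiff.comp hρ
  have h2 : HasCompactSupport fun t => (ρ t : ℂ) :=
    hs.comp_left (g := fun x : ℝ => (x : ℂ)) Complex.ofReal_zero
  obtain ⟨C, hC0, hC⟩ := exists_fourier_decay h1 h2 B
  refine ⟨C, hC0, fun s => ?_⟩
  have h3 : FourierTransform.fourier (fun t => (ρ t : ℂ)) (-s) = ∫ α, unitExp (s * α) * ρ α := by
    rw [Real.fourier_eq']
    refine integral_congr_ae (.of_forall fun t => ?_)
    have h4 : inner ℝ t (-s) = -(s * t) := by simp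
    beta_reduce
    rw [h4, smul_eq_mul, unitExp, show -2 * Real.pi * -(s * t) = 2 * Real.pi * (s * t) by ring]
  rw [← h3]
  refine le_trans ?_ (hC (-s))
  gcongr
  rw [norm_neg, Real.norm_eq_abs]
  linarith

/-- The mean square of an exponential polynomial is controlled by its close frequencies. -/
lemma integral_norm_sq_sum_le {σ : Type*} (J : Finset σ) (φ : σ → ℂ) (lam : σ → ℝ) {ρ : ℝ → ℝ}
    (hρ : Continuous ρ) (hs : HasCompactSupport ρ) (h0 : ∀ α, 0 ≤ ρ α) {C T δ : ℝ}
    (hC : ∀ j ∈ J, ‖φ j‖ ≤ C) (hδ0 : 0 ≤ δ)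
    (hδ : ∀ s, T < |s| → ‖∫ α, unitExp (s * α) * ρ α‖ ≤ δ) :
    ∫ α, ‖∑ j ∈ J, φ j * unitExp (α * lam j)‖ ^ 2 * ρ α ≤
      C ^ 2 * (((J ×ˢ J).filter fun z => |lam z.1 - lam z.2| ≤ T).card * (∫ α, ρ α) +
        (J.card : ℝ) ^ 2 * δ) := by
  have hρi : Integrable fun α => (ρ α : ℂ) := (hρ.integrable_of_hasCompactSupport hs).ofReal
  have hI : ∀ s, Integrable fun α => unitExp (s * α) * ρ α := fun s =>
    (hρi.bdd_mul (c := 1) (by fun_prop) (by simp))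
  have hIpos : 0 ≤ ∫ α, ρ α := integral_nonneg h0
  have h1 : ∀ α, ((‖∑ j ∈ J, φ j * unitExp (α * lam j)‖ ^ 2 * ρ α : ℝ) : ℂ) =
      ∑ z ∈ J ×ˢ J, φ z.1 * (starRingEnd ℂ) (φ z.2) *
        (unitExp ((lam z.1 - lam z.2) * α) * ρ α) := by
    intro α
    push_cast
    rw [← Complex.mul_conj', map_sum, Finset.sum_mul_sum, ← Finset.sum_product', Finset.sum_mul]
    refine Finset.sum_congr rfl fun z _ => ?_
    rw [map_mul, conj_unitExp, show (lam z.1 - lam z.2) * α = α * lam z.1 + -(α * lam z.2) by ring,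
      unitExp_add]
    ring
  have h2 : ((∫ α, ‖∑ j ∈ J, φ j * unitExp (α * lam j)‖ ^ 2 * ρ α : ℝ) : ℂ) =
      ∑ z ∈ J ×ˢ J, φ z.1 * (starRingEnd ℂ) (φ z.2) *
        ∫ α, unitExp ((lam z.1 - lam z.2) * α) * ρ α := by
    rw [← integral_complex_ofReal]
    simp only [h1]
    rw [integral_finsetSum _ fun z _ => (hI _).const_mul _]
    simp only [integral_const_mul]
  have h3 : ∀ z ∈ J ×ˢ J, ‖φ z.1 * (starRingEnd ℂ) (φ z.2) *
      ∫ α, unitExp ((lam z.1 - lam z.2) * α) * ρ α‖ ≤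
      C ^ 2 * ((if |lam z.1 - lam z.2| ≤ T then ∫ α, ρ α else 0) + δ) := by
    intro z hz
    obtain ⟨hz1, hz2⟩ := Finset.mem_product.1 hz
    rw [norm_mul, norm_mul, RCLike.norm_conj, pow_two]
    have hC0 : 0 ≤ C := (norm_nonneg _).trans (hC _ hz1)
    refine mul_le_mul (mul_le_mul (hC _ hz1) (hC _ hz2) (norm_nonneg _) hC0) ?_ (norm_nonneg _)
      (by positivity)
    split_ifs with hT
    · refine (norm_integral_le_integral_norm _).trans ?_
      have : ∀ α, ‖unitExp ((lam z.1 - lam z.2) * α) * (ρ α : ℂ)‖ = ρ α := fun α => by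
        rw [norm_mul, norm_unitExp, one_mul, Complex.norm_real, Real.norm_of_nonneg (h0 α)]
      simp only [this]
      linarith
    · rw [zero_add]
      exact hδ _ (not_le.1 hT)
  calc ∫ α, ‖∑ j ∈ J, φ j * unitExp (α * lam j)‖ ^ 2 * ρ α
      ≤ ‖((∫ α, ‖∑ j ∈ J, φ j * unitExp (α * lam j)‖ ^ 2 * ρ α : ℝ) : ℂ)‖ := by
        rw [Complex.norm_real]; exact Real.le_norm_self _
    _ ≤ ∑ z ∈ J ×ˢ J, C ^ 2 * ((if |lam z.1 - lam z.2| ≤ T then ∫ α, ρ α else 0) + δ) := by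
        rw [h2]; exact norm_sum_le_of_le _ h3
    _ = _ := by
        rw [← Finset.mul_sum, Finset.sum_add_distrib, ← Finset.sum_filter, Finset.sum_const,
          Finset.sum_const, nsmul_eq_mul, nsmul_eq_mul, Finset.card_product]
        push_cast
        ring

/-! ### Summation by parts for the frequencies. -/

section

variable {d : ℕ}

/-- The coefficients of `a (x i)` in `∑ n_i (a (x i) - a (x (i+1)))`. -/
def summationByPartsCoeff (n : Fin d → ℤ) (i : Fin (d + 1)) : ℤ :=
  Fin.snoc (α := fun _ => ℤ) n 0 i - Fin.cons (α := fun _ => ℤ) 0 n i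

lemma sum_summationByPartsCoeff {R : Type*} [Ring R] (n : Fin d → ℤ) (b : Fin (d + 1) → R) :
    ∑ i, (summationByPartsCoeff n i : R) * b i = ∑ i : Fin d, n i * (b i.castSucc - b i.succ) := by
  simp only [summationByPartsCoeff, Int.cast_sub, sub_mul, mul_sub, Finset.sum_sub_distrib]
  congr 1
  · rw [Fin.sum_univ_castSucc]; simp
  · rw [Fin.sum_univ_succ]; simp

lemma summationByPartsCoeff_injective :
    Function.Injective (summationByPartsCoeff : (Fin d → ℤ) → Fin (d + 1) → ℤ) := by
  -- The partial sums of the coefficients recover `n`: test the summation formula against the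
  -- indicator of an initial segment.
  have key : ∀ (n : Fin d → ℤ) (j : Fin d), n j =
      ∑ i, summationByPartsCoeff n i * (if i ≤ j.castSucc then 1 else 0) := by
    intro n j
    have h := sum_summationByPartsCoeff n fun i => if i ≤ j.castSucc then (1 : ℤ) else 0
    simp only [Int.cast_id] at h
    rw [h, Finset.sum_eq_single j]
    · simp [Fin.le_def]
    · intro i _ hij
      have : (i : ℕ) ≠ j := fun h => hij (Fin.ext h)
      simp only [Fin.le_def, Fin.val_castSucc, Fin.val_succ]
      split_ifs <;> omega
    · simp
  intro n n' h
  funext j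
  rw [key n j, key n' j, h]

@[simp] lemma summationByPartsCoeff_zero : summationByPartsCoeff (0 : Fin d → ℤ) = 0 := by
  funext i
  have h1 : Fin.snoc (α := fun _ => ℤ) (0 : Fin d → ℤ) 0 i = 0 := by
    refine Fin.lastCases ?_ (fun j => ?_) i <;> simp
  have h2 : Fin.cons (α := fun _ => ℤ) 0 (0 : Fin d → ℤ) i = 0 := by
    refine Fin.cases ?_ (fun j => ?_) i <;> simp
  rw [summationByPartsCoeff, h1, h2]
  rfl

lemma abs_summationByPartsCoeff_le {n : Fin d → ℤ} {B : ℕ} (hn : ∀ i, |n i| ≤ (B : ℤ))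
    (i : Fin (d + 1)) : |summationByPartsCoeff n i| ≤ ((2 * B : ℕ) : ℤ) := by
  have h1 : |Fin.snoc (α := fun _ => ℤ) n 0 i| ≤ (B : ℤ) := by
    refine Fin.lastCases ?_ (fun j => ?_) i
    · simp
    · simpa using hn j
  have h2 : |Fin.cons (α := fun _ => ℤ) 0 n i| ≤ (B : ℤ) := by
    refine Fin.cases ?_ (fun j => ?_) i
    · simp
    · simpa using hn j
  refine (abs_sub _ _).trans ?_
  push_cast
  linarith

end

/-! ### Choice of parameters and the count for the truncated sum. -/

/-- Between the extreme indices `m ≤ M` the sequence grows by at least `c ^ (M - m)`, so `M - m ≤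
log Λ / log c`. -/
lemma card_le_of_geometric_growth {a : ℕ → ℝ} {c : ℝ} (hc : 1 < c) (ha : 0 < a 1)
    (hgrow : ∀ n, 1 ≤ n → c * a n ≤ a (n + 1)) {Λ : ℝ} (hΛ : 0 < Λ) {W : ℕ}
    (hW : 1 + Real.log Λ / Real.log c ≤ W) (s : Finset ℕ) (lo : ℝ)
    (hs : ∀ x ∈ s, 1 ≤ x ∧ lo ≤ a x ∧ a x ≤ Λ * lo) : s.card ≤ W := by
  have hpos : ∀ n, 1 ≤ n → 0 < a n := fun n hn => by
    induction n, hn using Nat.le_induction with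
    | base => exact ha
    | succ n hn ih => exact (mul_pos (one_pos.trans hc) ih).trans_le (hgrow n hn)
  have hpow : ∀ n j, 1 ≤ n → c ^ j * a n ≤ a (n + j) := fun n j hn => by
    induction j with
    | zero => simp
    | succ j ih =>
      calc c ^ (j + 1) * a n = c * (c ^ j * a n) := by ring
        _ ≤ c * a (n + j) := by gcongr
        _ ≤ _ := hgrow _ (by omega)
  rcases s.eq_empty_or_nonempty with rfl | hne
  · simp
  have h1 := hs _ (s.min'_mem hne)
  have h2 := hs _ (s.max'_mem hne)
  set m := s.min' hne
  set M := s.max' hne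
  have hmM : m ≤ M := s.min'_le_max' hne
  have hm := hpos m h1.1
  have h3 : c ^ (M - m) ≤ Λ := by
    have h4 := hpow m (M - m) h1.1
    rw [Nat.add_sub_cancel' hmM] at h4
    have h5 : c ^ (M - m) * a m ≤ Λ * a m :=
      (h4.trans h2.2.2).trans (mul_le_mul_of_nonneg_left h1.2.1 hΛ.le)
    exact le_of_mul_le_mul_right h5 hm
  have h4 : ((M - m : ℕ) : ℝ) * Real.log c ≤ Real.log Λ := by
    rw [← Real.log_pow]
    exact Real.log_le_log (by positivity) h3
  have h5 : ((M - m : ℕ) : ℝ) ≤ Real.log Λ / Real.log c := by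
    rwa [le_div_iff₀ (Real.log_pos hc)]
  have h6 : s.card ≤ M - m + 1 := by
    have hsub : s ⊆ Finset.Icc m M := fun x hx =>
      Finset.mem_Icc.2 ⟨s.min'_le x hx, s.le_max' x hx⟩
    have := Finset.card_le_card hsub
    rw [Nat.card_Icc] at this
    omega
  have h7 : ((M - m + 1 : ℕ) : ℝ) ≤ W := by push_cast; linarith
  exact h6.trans (by exact_mod_cast h7)

lemma exists_countingData {a₁ c ε : ℝ} (ha₁ : 0 < a₁) (hc : 1 < c) (hε : 0 < ε) (hε1 : ε ≤ 1)
    {k : ℕ} (hk : 1 ≤ k) : ∃ D : ℝ, 0 < D ∧ ∀ a : ℕ → ℝ, a 1 = a₁ →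
      (∀ n : ℕ, 1 ≤ n → c * a n ≤ a (n + 1)) → ∀ N : ℕ, 1 ≤ N → ∃ (Λ : ℝ) (W : ℕ),
      CountingData a c ((N : ℝ) ^ ε) Λ k N (2 * ⌊(N : ℝ) ^ (1 + ε)⌋₊) W ∧
        (W : ℝ) ≤ D * (N : ℝ) ^ ε := by
  -- With `Λ = Q N ^ 2`, the first summand serves `ratio` (as `M ≤ 2 N ^ 2`) and the second serves
  -- `ratio_T`.
  set Q : ℝ := 16 * k + 6 / a₁ with hQ
  have hQ0 : 0 < Q := by positivity
  have hlogc := Real.log_pos hc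
  have hc1 : 0 < c - 1 := by linarith
  set D₁ : ℝ := 2 / ε * Q ^ (ε / 2) / Real.log c with hD₁
  have hD₁0 : 0 ≤ D₁ := by positivity
  -- The summands are the demands of `coeff`, `window`, `short` and `short_diff` on `W / N ^ ε`.
  set D₀ : ℝ := 5 + (1 + D₁) + (2 / a₁ + 2) + (c / (c - 1) + 1) with hD₀
  have hcc : 0 < c / (c - 1) := by positivity
  have haa : 0 < 2 / a₁ := by positivity
  have hD₀0 : 0 < D₀ := by positivity
  refine ⟨D₀ + 1, by positivity, fun a ha hgrow N hN => ?_⟩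
  have hN1 : (1 : ℝ) ≤ N := by exact_mod_cast hN
  have hN0 : (0 : ℝ) < N := by linarith
  set X : ℝ := (N : ℝ) ^ ε with hX
  have hX1 : 1 ≤ X := Real.one_le_rpow hN1 hε.le
  have hXN : X ≤ N := by
    calc X ≤ (N : ℝ) ^ (1 : ℝ) := Real.rpow_le_rpow_of_exponent_le hN1 hε1
      _ = N := Real.rpow_one _
  have hNX : (N : ℝ) ^ (1 + ε) = N * X := by rw [Real.rpow_add hN0, Real.rpow_one]
  rw [hNX]
  set B : ℕ := ⌊(N : ℝ) * X⌋₊ with hB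
  have hBle : (B : ℝ) ≤ N * X := Nat.floor_le (by positivity)
  have hB1 : 1 ≤ B := Nat.le_floor (by push_cast; nlinarith)
  set W : ℕ := ⌈D₀ * X⌉₊ with hW
  have hWge : D₀ * X ≤ W := Nat.le_ceil _
  have hWle : (W : ℝ) ≤ (D₀ + 1) * X := by
    have := Nat.ceil_lt_add_one (show 0 ≤ D₀ * X by positivity)
    linarith
  have hNN : (N : ℝ) * X ≤ N ^ 2 := by nlinarith
  refine ⟨Q * N ^ 2, W, ?_, hWle⟩
  have hWX : ∀ y, y ≤ D₀ → y * X ≤ W := fun y hy =>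
    (mul_le_mul_of_nonneg_right hy (by linarith)).trans hWge
  have hWX1 : ∀ y, 0 ≤ y → y ≤ D₀ → y ≤ W := fun y hy0 hy =>
    (le_mul_of_one_le_right hy0 hX1).trans (hWX y hy)
  refine ⟨hc, ha ▸ ha₁, hgrow, hN, by omega, by linarith, ?_, ?_, ?_, ?_, ?_, ?_⟩
  · have h1 : 5 * X ≤ W := hWX 5 (by linarith)
    have h2 : (1 : ℝ) ≤ N * X := by nlinarith
    have h3 : ((2 * (2 * B) + 1 : ℕ) : ℝ) ≤ (W * N : ℕ) := by
      push_cast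
      nlinarith
    exact_mod_cast h3
  · refine card_le_of_geometric_growth hc (ha ▸ ha₁) hgrow (by positivity) ?_
    -- The exponent `ε / 2` is used because `Λ` is quadratic in `N`.
    have h1 := Real.log_le_rpow_div (x := Q * N ^ 2) (by positivity) (half_pos hε)
    have h2 : (Q * (N : ℝ) ^ 2) ^ (ε / 2) = Q ^ (ε / 2) * X := by
      rw [Real.mul_rpow hQ0.le (by positivity), ← Real.rpow_natCast, ← Real.rpow_mul hN0.le, hX]
      congr 2
      push_cast
      ring
    rw [h2] at h1
    have h3 : Real.log (Q * N ^ 2) / Real.log c ≤ D₁ * X := by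
      rw [div_le_iff₀ hlogc]
      refine h1.trans (le_of_eq ?_)
      rw [hD₁]
      field_simp
    have h4 := hWX (1 + D₁) (by linarith)
    linarith
  · push_cast
    have : 0 ≤ 6 / a₁ * (N : ℝ) ^ 2 := by positivity
    calc 8 * (k : ℝ) * (2 * B) = 16 * k * B := by ring
      _ ≤ 16 * k * N ^ 2 := by gcongr; linarith
      _ ≤ Q * N ^ 2 := by rw [hQ]; linarith
  · rw [ha]
    have h1 : Q * N ^ 2 * a₁ = 16 * k * N ^ 2 * a₁ + 6 * N ^ 2 := by
      rw [hQ]; field_simp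
    have h2 : (0 : ℝ) ≤ 16 * k * N ^ 2 * a₁ := by positivity
    rw [h1]
    nlinarith
  · rw [ha]
    have h1 := hWX (2 / a₁ + 2) (by linarith)
    have h2 : 2 * (X / a₁) = 2 / a₁ * X := by ring
    nlinarith
  · exact hWX1 _ (by linarith) (by linarith)

/-- The number of close pairs among the frequencies of the truncated correlation sum. -/
lemma CountingData.card_close_le {d : ℕ} {a : ℕ → ℝ} {c T Λ : ℝ} {N B W : ℕ}
    (h : CountingData a c T Λ (d + 1) N (2 * B) W) :
    ((((intCube (Fin d) B).erase 0 ×ˢ distinctTuples (d + 1) N) ×ˢ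
      ((intCube (Fin d) B).erase 0 ×ˢ distinctTuples (d + 1) N)).filter fun z =>
        |(∑ i, (z.1.1 i : ℝ) * consecutiveDiff (k := d + 1) a z.1.2 i) -
          ∑ i, (z.2.1 i : ℝ) * consecutiveDiff (k := d + 1) a z.2.2 i| ≤ T).card * N ≤
      (d + 2) ^ 2 * ((d + 2) * (2 ^ (d + 1) * (d + 2) ^ (d + 1)) *
        (4 * (4 * W ^ 2) ^ (d + 1))) ^ 2 * N ^ (2 * (d + 1)) := by
  classical
  set J := (intCube (Fin d) B).erase 0 ×ˢ distinctTuples (d + 1) N with hJ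
  let ψ : (Fin d → ℤ) × (Fin (d + 1) → ℕ) → (Fin (d + 1) → ℤ) × (Fin (d + 1) → ℕ) :=
    fun z => (summationByPartsCoeff z.1, z.2)
  have hψ : Function.Injective ψ := fun z w hzw => by
    obtain ⟨h1, h2⟩ := Prod.mk.inj hzw
    exact Prod.ext (summationByPartsCoeff_injective h1) h2
  have hfreq : ∀ z, frequency a (ψ z) =
      ∑ i, (z.1 i : ℝ) * consecutiveDiff (k := d + 1) a z.2 i := fun z =>
    sum_summationByPartsCoeff z.1 fun i => a (z.2 i)
  rw [← Finset.card_image_of_injective _ (hψ.prodMap hψ)]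
  refine h.card_pairs_le (J.image ψ) (fun w hw => ?_) _ fun w hw => ?_
  · obtain ⟨z, hz, rfl⟩ := Finset.mem_image.1 hw
    obtain ⟨hz1, hz2⟩ := Finset.mem_product.1 hz
    obtain ⟨hz0, hzB⟩ := Finset.mem_erase.1 hz1
    obtain ⟨hx1, hx2⟩ := mem_distinctTuples.1 hz2
    refine ⟨fun h0 => hz0 (summationByPartsCoeff_injective (h0.trans summationByPartsCoeff_zero.symm)), ?_,
      abs_summationByPartsCoeff_le (mem_intCube.1 hzB), hx1, hx2⟩
    · have := sum_summationByPartsCoeff z.1 fun _ => (1 : ℤ)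
      simpa using this
  · obtain ⟨z, hz, rfl⟩ := Finset.mem_image.1 hw
    obtain ⟨hz1, hz2⟩ := Finset.mem_filter.1 hz
    obtain ⟨hz3, hz4⟩ := Finset.mem_product.1 hz1
    refine ⟨Finset.mem_image_of_mem _ hz3, Finset.mem_image_of_mem _ hz4, ?_⟩
    simp only [Prod.map_fst, Prod.map_snd, hfreq]
    exact hz2

lemma card_intCube_prod_distinctTuples_le {d N B : ℕ} (hN : 1 ≤ N) (hB : B ≤ N ^ 2) :
    ((intCube (Fin d) B).erase 0 ×ˢ distinctTuples (d + 1) N).card ≤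
      3 ^ (d + 1) * N ^ (3 * (d + 1)) := by
  rw [Finset.card_product, card_distinctTuples]
  have h1 : ((intCube (Fin d) B).erase 0).card ≤ (3 * N ^ 2) ^ d := by
    refine (Finset.card_le_card (Finset.erase_subset _ _)).trans ?_
    rw [intCube, Fintype.card_piFinset_const, Int.card_Icc]
    have : 1 ≤ N ^ 2 := Nat.one_le_pow _ _ hN
    gcongr
    omega
  calc _ ≤ (3 * N ^ 2) ^ d * N ^ (d + 1) := Nat.mul_le_mul h1 (Nat.descFactorial_le_pow N (d + 1))
    _ = 3 ^ d * N ^ (2 * d + (d + 1)) := by rw [mul_pow, ← pow_mul, pow_add]; ring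
    _ ≤ _ := by
      gcongr <;> omega

/-! ### Assembly of the variance bound. -/

set_option maxHeartbeats 1000000 in
theorem proposition3p1
    (k : ℕ) (hk : 2 ≤ k)
    (f : (Fin (k - 1) → ℝ) → ℝ) (hf : ContDiff ℝ ∞ f) (hf_supp : HasCompactSupport f)
    (ρ : ℝ → ℝ) (hρ : ContDiff ℝ ∞ ρ) (hρ_supp : HasCompactSupport ρ) (hρ_nonneg : ∀ α, 0 ≤ ρ α)
    (a₁ : ℝ) (ha₁ : 0 < a₁) (c : ℝ) (hc : 1 < c)
    (η : ℝ) (hη : 0 < η) :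
    ∃ C : ℝ, ∀ a : ℕ → ℝ, a 1 = a₁ → (∀ n : ℕ, 1 ≤ n → c * a n ≤ a (n + 1)) →
      ∀ N : ℕ, 1 ≤ N →
        Integrable (varianceIntegrand k f ρ a N) ∧
        correlationVariance k f ρ a N ≤ C * (N : ℝ) ^ (-1 + η) := by
  obtain ⟨d, rfl⟩ : ∃ d, k = d + 1 := ⟨k - 1, by omega⟩
  have hk1 : 1 ≤ d + 1 := by omega
  change (Fin d → ℝ) → ℝ at f
  -- The pair count involves `W ^ (4 (d + 1))` with `W = O(N ^ ε)`, which must stay below a constant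
  -- times `N ^ η`.
  set ε : ℝ := min 1 (η / (4 * (d + 1))) with hε
  have hε0 : 0 < ε := by positivity
  have hε1 : ε ≤ 1 := min_le_left _ _
  have hεη : 4 * (d + 1) * ε ≤ η := by
    have : ε ≤ η / (4 * (d + 1)) := min_le_right _ _
    rwa [le_div_iff₀' (by positivity)] at this
  obtain ⟨D, hD0, hD⟩ := exists_countingData ha₁ hc hε0 hε1 hk1
  -- Decay of order `A` beyond `N ^ ε` then gains `N ^ (6 (d + 1))`, which beats the square of the
  -- number `O(N ^ (3 (d + 1)))` of terms and also the truncation loss.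
  set A : ℕ := ⌈6 * ((d : ℝ) + 1) / ε⌉₊ with hA
  have hAε : 6 * ((d : ℝ) + 1) ≤ ε * A := by
    have := Nat.le_ceil (6 * ((d : ℝ) + 1) / ε)
    rwa [div_le_iff₀' hε0] at this
  obtain ⟨Ct, hCt0, hCt⟩ := exists_norm_sub_sum_le hf hf_supp hk1 A
  obtain ⟨Cρ, hCρ0, hCρ⟩ := exists_integral_unitExp_decay hρ hρ_supp A
  obtain ⟨C₀, hC₀0, hC₀⟩ := exists_coordFourier_decay (contDiff_ofReal_comp (k := d + 1) hf)
    (hasCompactSupport_ofReal_comp hf_supp) 0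
  simp only [pow_zero, one_mul] at hC₀
  set I : ℝ := ∫ α, ρ α with hI
  have hI0 : 0 ≤ I := integral_nonneg hρ_nonneg
  have hρi : Integrable ρ := hρ.continuous.integrable_of_hasCompactSupport hρ_supp
  set K : ℝ := (d + 2) ^ 2 * ((d + 2) * (2 ^ (d + 1) * (d + 2) ^ (d + 1)) *
        (4 * 4 ^ (d + 1))) ^ 2 with hK
  refine ⟨2 * (C₀ ^ 2 * (K * D ^ (4 * (d + 1)) * I + (3 ^ (d + 1)) ^ 2 * Cρ)) + 2 * Ct ^ 2 * I,
    fun a ha hgrow N hN => ⟨integrable_varianceIntegrand hf hf_supp hk1 hρ.continuous hρ_supp a hN,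
      ?_⟩⟩
  obtain ⟨Λ, W, hcount, hW⟩ := hD a ha hgrow N hN
  have hN1 : (1 : ℝ) ≤ N := by exact_mod_cast hN
  have hN0 : (0 : ℝ) < N := by linarith
  set X : ℝ := (N : ℝ) ^ ε with hX
  have hX1 : 1 ≤ X := Real.one_le_rpow hN1 hε0.le
  have hNX : (N : ℝ) ^ (1 + ε) = N * X := by rw [Real.rpow_add hN0, Real.rpow_one]
  set B : ℕ := ⌊(N : ℝ) ^ (1 + ε)⌋₊ with hB
  have hBle : B ≤ N ^ 2 := by
    have h1 : (B : ℝ) ≤ N * X := by rw [← hNX]; exact Nat.floor_le (by positivity)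
    have h2 : X ≤ N := by
      calc X ≤ (N : ℝ) ^ (1 : ℝ) := Real.rpow_le_rpow_of_exponent_le hN1 hε1
        _ = N := Real.rpow_one _
    have h3 : (B : ℝ) ≤ (N ^ 2 : ℕ) := by push_cast; nlinarith
    exact_mod_cast h3
  have hXA : (N : ℝ) ^ (6 * (d + 1)) ≤ X ^ A := by
    rw [hX, ← Real.rpow_natCast, ← Real.rpow_natCast, ← Real.rpow_mul hN0.le]
    refine Real.rpow_le_rpow_of_exponent_le hN1 ?_
    push_cast
    exact hAε
  have hXη : X ^ (4 * (d + 1)) ≤ (N : ℝ) ^ η := by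
    rw [hX, ← Real.rpow_natCast, ← Real.rpow_mul hN0.le]
    refine Real.rpow_le_rpow_of_exponent_le hN1 ?_
    push_cast
    linarith
  have hNη : 1 ≤ (N : ℝ) ^ η := Real.one_le_rpow hN1 hη.le
  have hNη' : (N : ℝ) ^ (-1 + η) = (N : ℝ)⁻¹ * N ^ η := by
    rw [Real.rpow_add hN0, Real.rpow_neg_one]
  set J := (intCube (Fin d) B).erase 0 ×ˢ distinctTuples (d + 1) N with hJ
  let φ : (Fin d → ℤ) × (Fin (d + 1) → ℕ) → ℂ := fun z =>
    ((N : ℂ) ^ (d + 1))⁻¹ * coordFourier (fun t => (f t : ℂ)) fun i => (z.1 i : ℝ) / N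
  let lam : (Fin d → ℤ) × (Fin (d + 1) → ℕ) → ℝ := fun z =>
    ∑ i, (z.1 i : ℝ) * consecutiveDiff (k := d + 1) a z.2 i
  have hsum : ∀ α : ℝ, ∑ n ∈ (intCube (Fin d) B).erase 0,
      correlationTerm (d + 1) f (fun n => α * a n) N n =
      ∑ j ∈ J, φ j * unitExp (α * lam j) := by
    intro α
    rw [hJ, Finset.sum_product]
    refine Finset.sum_congr rfl fun n _ => ?_
    rw [correlationTerm, ← mul_assoc, Finset.mul_sum]
    refine Finset.sum_congr rfl fun x _ => ?_
    have : ∑ i, (n i : ℝ) * consecutiveDiff (k := d + 1) (fun n => α * a n) x i =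
        α * lam (n, x) := by
      simp only [lam, Finset.mul_sum, consecutiveDiff]
      refine Finset.sum_congr rfl fun i _ => ?_
      ring
    rw [← this]
    rfl
  -- the truncation error
  have hE : ∀ α : ℝ, ‖((correlationSum (d + 1) f (fun n => α * a n) N -
      diagFactor (d + 1) N * ∫ t, f t : ℝ) : ℂ) - ∑ j ∈ J, φ j * unitExp (α * lam j)‖ ≤
      Ct * (N : ℝ)⁻¹ := by
    intro α
    have h1 := hCt (fun n => α * a n) N B hN
    rw [← hsum α]
    -- As `B` is the floor of `N ^ (1 + ε)`, outside the cube some `|n i| / N` is at least `(B + 1)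
    -- / N ≥ N ^ ε`.
    have h2 : (N : ℝ) ^ (6 * (d + 1)) ≤ (1 + ((B : ℝ) + 1) / N) ^ A := by
      refine hXA.trans ?_
      have h3 : X ≤ ((B : ℝ) + 1) / N := by
        rw [le_div_iff₀ hN0, mul_comm, ← hNX]
        exact (Nat.lt_floor_add_one _).le
      gcongr
      linarith
    have h3 := (mul_le_mul_of_nonneg_right h2 (norm_nonneg _)).trans h1
    have h4 : (N : ℝ) ^ (2 * (d + 1 - 1)) ≤ N ^ (6 * (d + 1)) * (N : ℝ)⁻¹ := by
      rw [← div_eq_mul_inv, le_div_iff₀ hN0, ← pow_succ]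
      exact pow_le_pow_right₀ hN1 (by omega)
    refine le_of_mul_le_mul_left (h3.trans ?_) (show (0 : ℝ) < N ^ (6 * (d + 1)) by positivity)
    calc Ct * (N : ℝ) ^ (2 * (d + 1 - 1)) ≤ Ct * (N ^ (6 * (d + 1)) * (N : ℝ)⁻¹) := by gcongr
      _ = _ := by ring
  -- the mean square of the main part
  set S : ℝ := ∫ α, ‖∑ j ∈ J, φ j * unitExp (α * lam j)‖ ^ 2 * ρ α with hS
  have hScont : Continuous fun α => ‖∑ j ∈ J, φ j * unitExp (α * lam j)‖ ^ 2 * ρ α := by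
    have := hρ.continuous
    fun_prop
  have hSint : Integrable fun α => ‖∑ j ∈ J, φ j * unitExp (α * lam j)‖ ^ 2 * ρ α :=
    hScont.integrable_of_hasCompactSupport hρ_supp.mul_left
  have hSle : S ≤ C₀ ^ 2 * (K * D ^ (4 * (d + 1)) * I + (3 ^ (d + 1)) ^ 2 * Cρ) *
      (N : ℝ) ^ (-1 + η) := by
    have h1 := integral_norm_sq_sum_le J φ lam hρ.continuous hρ_supp hρ_nonneg
      (C := ((N : ℝ) ^ (d + 1))⁻¹ * C₀) (T := X) (δ := Cρ * ((N : ℝ) ^ (6 * (d + 1)))⁻¹)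
      (fun j _ => by
        rw [norm_mul, norm_inv, norm_pow, Complex.norm_natCast]
        gcongr
        exact hC₀ _) (by positivity) (fun s hs => by
        rw [← div_eq_mul_inv, le_div_iff₀ (by positivity), mul_comm]
        refine le_trans ?_ (hCρ s)
        gcongr
        exact hXA.trans (pow_le_pow_left₀ (by linarith) hs.le A))
    have h2 : ((((J ×ˢ J).filter fun z => |lam z.1 - lam z.2| ≤ X).card : ℕ) : ℝ) ≤
        K * D ^ (4 * (d + 1)) * N ^ η * N ^ (2 * (d + 1)) * (N : ℝ)⁻¹ := by
      rw [← div_eq_mul_inv, le_div_iff₀ hN0]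
      have h3 := hcount.card_close_le
      have h4 : ((((J ×ˢ J).filter fun z => |lam z.1 - lam z.2| ≤ X).card : ℕ) : ℝ) * N ≤
          (d + 2) ^ 2 * ((d + 2) * (2 ^ (d + 1) * (d + 2) ^ (d + 1)) *
        (4 * (4 * W ^ 2) ^ (d + 1))) ^ 2 * N ^ (2 * (d + 1)) := by exact_mod_cast h3
      refine h4.trans ?_
      gcongr ?_ * _
      calc ((d : ℝ) + 2) ^ 2 * ((d + 2) * (2 ^ (d + 1) * (d + 2) ^ (d + 1)) *
            (4 * (4 * W ^ 2) ^ (d + 1))) ^ 2 = K * (W : ℝ) ^ (4 * (d + 1)) := by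
            rw [hK, show (4 * (W : ℝ) ^ 2) ^ (d + 1) = 4 ^ (d + 1) * (W ^ (d + 1)) ^ 2 by
              rw [mul_pow, ← pow_mul, ← pow_mul, mul_comm 2], mul_comm 4 (d + 1), pow_mul (W : ℝ)]
            ring
        _ ≤ K * (D * X) ^ (4 * (d + 1)) := by gcongr
        _ = K * D ^ (4 * (d + 1)) * X ^ (4 * (d + 1)) := by rw [mul_pow]; ring
        _ ≤ _ := by gcongr
    have h5 : (J.card : ℝ) ≤ 3 ^ (d + 1) * N ^ (3 * (d + 1)) := by
      exact_mod_cast card_intCube_prod_distinctTuples_le (d := d) hN hBle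
    have h6 : (J.card : ℝ) ^ 2 * (Cρ * ((N : ℝ) ^ (6 * (d + 1)))⁻¹) ≤ (3 ^ (d + 1)) ^ 2 * Cρ := by
      calc (J.card : ℝ) ^ 2 * (Cρ * ((N : ℝ) ^ (6 * (d + 1)))⁻¹)
          ≤ (3 ^ (d + 1) * N ^ (3 * (d + 1))) ^ 2 * (Cρ * ((N : ℝ) ^ (6 * (d + 1)))⁻¹) := by gcongr
        _ = (3 ^ (d + 1)) ^ 2 * Cρ * (N ^ (6 * (d + 1)) * ((N : ℝ) ^ (6 * (d + 1)))⁻¹) := by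
          rw [mul_pow, ← pow_mul (N : ℝ), show 3 * (d + 1) * 2 = 6 * (d + 1) by ring]
          ring
        _ = _ := by rw [mul_inv_cancel₀ (by positivity), mul_one]
    have h7 : (1 : ℝ) ≤ N ^ η * N ^ (2 * (d + 1)) * (N : ℝ)⁻¹ := by
      have : (1 : ℝ) ≤ N ^ (2 * (d + 1)) * (N : ℝ)⁻¹ := by
        rw [← div_eq_mul_inv, le_div_iff₀ hN0, one_mul]
        exact le_self_pow₀ hN1 (by omega)
      calc (1 : ℝ) ≤ N ^ η * (N ^ (2 * (d + 1)) * (N : ℝ)⁻¹) := one_le_mul_of_one_le_of_one_le hNη this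
        _ = _ := by ring
    calc S ≤ _ := h1
      _ ≤ (((N : ℝ) ^ (d + 1))⁻¹ * C₀) ^ 2 *
          (K * D ^ (4 * (d + 1)) * N ^ η * N ^ (2 * (d + 1)) * (N : ℝ)⁻¹ * I +
            (3 ^ (d + 1)) ^ 2 * Cρ * (N ^ η * N ^ (2 * (d + 1)) * (N : ℝ)⁻¹)) := by
          refine mul_le_mul_of_nonneg_left (add_le_add (mul_le_mul_of_nonneg_right h2 hI0) ?_)
            (by positivity)
          exact h6.trans (le_mul_of_one_le_right (by positivity) h7)
      _ = C₀ ^ 2 * (K * D ^ (4 * (d + 1)) * I + (3 ^ (d + 1)) ^ 2 * Cρ) *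
          ((N : ℝ)⁻¹ * N ^ η) * ((N : ℝ) ^ (2 * (d + 1)) * ((N : ℝ) ^ (2 * (d + 1)))⁻¹) := by
          rw [mul_pow, inv_pow, ← pow_mul, mul_comm (d + 1) 2]
          ring
      _ = _ := by rw [mul_inv_cancel₀ (by positivity), mul_one, hNη']
  have hpt : ∀ α, varianceIntegrand (d + 1) f ρ a N α ≤
      2 * (‖∑ j ∈ J, φ j * unitExp (α * lam j)‖ ^ 2 * ρ α) + 2 * (Ct * (N : ℝ)⁻¹) ^ 2 * ρ α := by
    intro α
    have h1 := hE α
    set r : ℝ := correlationSum (d + 1) f (fun n => α * a n) N - diagFactor (d + 1) N * ∫ t, f t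
      with hr
    set z := ∑ j ∈ J, φ j * unitExp (α * lam j)
    have h2 : |r| ≤ ‖z‖ + Ct * (N : ℝ)⁻¹ := by
      have := norm_le_norm_add_norm_sub' (r : ℂ) z
      rw [Complex.norm_real, Real.norm_eq_abs] at this
      linarith
    have h3 : |r| ^ 2 ≤ 2 * ‖z‖ ^ 2 + 2 * (Ct * (N : ℝ)⁻¹) ^ 2 := by
      have := pow_le_pow_left₀ (abs_nonneg r) h2 2
      nlinarith [sq_nonneg (‖z‖ - Ct * (N : ℝ)⁻¹)]
    calc varianceIntegrand (d + 1) f ρ a N α = |r| ^ 2 * ρ α := rfl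
      _ ≤ (2 * ‖z‖ ^ 2 + 2 * (Ct * (N : ℝ)⁻¹) ^ 2) * ρ α :=
        mul_le_mul_of_nonneg_right h3 (hρ_nonneg α)
      _ = _ := by ring
  have hNinv : ((N : ℝ)⁻¹) ^ 2 ≤ (N : ℝ) ^ (-1 + η) := by
    rw [hNη', pow_two]
    gcongr
    exact (inv_le_one_of_one_le₀ hN1).trans hNη
  calc correlationVariance (d + 1) f ρ a N
      ≤ ∫ α, (2 * (‖∑ j ∈ J, φ j * unitExp (α * lam j)‖ ^ 2 * ρ α) +
          2 * (Ct * (N : ℝ)⁻¹) ^ 2 * ρ α) :=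
        integral_mono (integrable_varianceIntegrand hf hf_supp hk1 hρ.continuous hρ_supp a hN)
          ((hSint.const_mul 2).add (hρi.const_mul _)) hpt
    _ = 2 * S + 2 * (Ct * (N : ℝ)⁻¹) ^ 2 * I := by
        rw [integral_add (hSint.const_mul 2) (hρi.const_mul _), integral_const_mul,
          integral_const_mul]
    _ = 2 * S + 2 * Ct ^ 2 * I * ((N : ℝ)⁻¹) ^ 2 := by ring
    _ ≤ 2 * (C₀ ^ 2 * (K * D ^ (4 * (d + 1)) * I + (3 ^ (d + 1)) ^ 2 * Cρ) * (N : ℝ) ^ (-1 + η)) +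
        2 * Ct ^ 2 * I * (N : ℝ) ^ (-1 + η) := by gcongr
    _ = _ := by ring
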